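/- For a unital subhomogeneous C*-algebra $A$ (that is, the dimensions of the irreducible representations of $A$ are finite and bounded) let $\mathrm{Prim}_d(A)$ be the set of the kernels of the $d$-dimensional irreducible representations of $A$, with the topology induced by the hull-kernel topology of the primitive ideal space of $A$, and put $$\mathrm{dimRatio}(A)=\max_d \frac{\dim(\mathrm{Prim}_d(A))}{d}\in[0,\infty],$$ where $d$ runs over the dimensions of the irreducible representations of $A$ and $\dim$ is the topological covering dimension (if $A=0$, put $\mathrm{dimRatio}(A)=0$). Let $C$ and $S$ be separable unital subhomogeneous C*-algebras, and let $J\geq 1$ be a natural number such that each irreducible representation of $C$ or $S$ has dimension at least $J$. Let $C\otimes S$ be their (spatial) C*-algebra tensor product. Then $C\otimes S$ is subhomogeneous, and $$\mathrm{dimRatio}(C\otimes S)\leq \frac{\mathrm{dimRatio}(C)+\mathrm{dimRatio}(S)}{J}.$$ -/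

import Mathlib

open scoped TensorProduct ComplexOrder ENNReal

universe u v

noncomputable section

/-! ### Topological covering dimension -/

/-- `dim X ≤ n`: every finite open cover of `X` has a finite open refinement (covering `X`) such
that every point lies in at most `n + 1` of its members. -/
def CoveringDimLE (X : Type*) [TopologicalSpace X] (n : ℕ) : Prop :=
  ∀ 𝒰 : Set (Set X), 𝒰.Finite → (∀ U ∈ 𝒰, IsOpen U) → ⋃₀ 𝒰 = Set.univ →
    ∃ 𝒱 : Set (Set X), 𝒱.Finite ∧ (∀ V ∈ 𝒱, IsOpen V) ∧ ⋃₀ 𝒱 = Set.univ ∧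
      (∀ V ∈ 𝒱, ∃ U ∈ 𝒰, V ⊆ U) ∧ ∀ x : X, {V ∈ 𝒱 | x ∈ V}.encard ≤ n + 1

/-- The covering dimension of a nonempty space, with value `⊤` if it is infinite. (It is used for
nonempty spaces only, so the convention `dim ∅ = -1` plays no role.) -/
def coveringDim (X : Type*) [TopologicalSpace X] : ℕ∞ :=
  ⨅ (n : ℕ) (_ : CoveringDimLE X n), (n : ℕ∞)

/-! ### Irreducible representations and the primitive spectrum -/

/-- A (unital) `*`-representation on a Hilbert space is irreducible if the space is nonzero and has
no closed invariant subspaces other than the trivial ones. -/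
structure IsIrreducibleRep {A : Type*} [CStarAlgebra A] {H : Type*} [NormedAddCommGroup H]
    [InnerProductSpace ℂ H] [CompleteSpace H] (π : A →⋆ₐ[ℂ] (H →L[ℂ] H)) : Prop where
  nontrivial : Nontrivial H
  eq_bot_or_eq_top : ∀ M : Submodule ℂ H, IsClosed (M : Set H) →
    (∀ a : A, ∀ x ∈ M, π a x ∈ M) → M = ⊥ ∨ M = ⊤

/-- A C⋆-algebra is subhomogeneous if the dimensions of its irreducible representations are finite
and bounded. (Every irreducible representation of `A` is equivalent to one on a Hilbert space in
the universe of `A`, by the GNS construction.) -/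
def IsSubhomogeneous (A : Type u) [CStarAlgebra A] : Prop :=
  ∃ N : ℕ, ∀ (H : Type u) [NormedAddCommGroup H] [InnerProductSpace ℂ H] [CompleteSpace H]
    (π : A →⋆ₐ[ℂ] (H →L[ℂ] H)), IsIrreducibleRep π →
      FiniteDimensional ℂ H ∧ Module.finrank ℂ H ≤ N

/-- Every irreducible representation of `A` has dimension at least `J`. -/
def IrrepsDimGE (A : Type u) [CStarAlgebra A] (J : ℕ) : Prop :=
  ∀ (H : Type u) [NormedAddCommGroup H] [InnerProductSpace ℂ H] [CompleteSpace H]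
    (π : A →⋆ₐ[ℂ] (H →L[ℂ] H)), IsIrreducibleRep π → (J : Cardinal) ≤ Module.rank ℂ H

/-- A primitive ideal is the kernel of an irreducible representation. -/
def IsPrimitiveIdeal {A : Type u} [CStarAlgebra A] (P : Ideal A) : Prop :=
  ∃ (H : Type u) (_ : NormedAddCommGroup H) (_ : InnerProductSpace ℂ H) (_ : CompleteSpace H)
    (π : A →⋆ₐ[ℂ] (H →L[ℂ] H)), IsIrreducibleRep π ∧ RingHom.ker π = P

/-- The primitive spectrum `Prim A`. -/
def PrimitiveSpectrum (A : Type u) [CStarAlgebra A] : Type u :=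
  {P : Ideal A // IsPrimitiveIdeal P}

/-- Primitive ideals are prime: if `a` and `b` lie outside `P`, then so does `a * c * b` for
some `c`. -/
theorem IsPrimitiveIdeal.exists_mul_mul_notMem {A : Type u} [CStarAlgebra A] {P : Ideal A}
    (hP : IsPrimitiveIdeal P) {a b : A} (ha : a ∉ P) (hb : b ∉ P) : ∃ c : A, a * c * b ∉ P := by
  obtain ⟨H, _, _, _, π, hπ, rfl⟩ := hP
  by_contra! h
  simp only [RingHom.mem_ker] at ha hb h
  obtain ⟨y, hy⟩ : ∃ y, π b y ≠ 0 := by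
    by_contra! h0
    exact hb (ContinuousLinearMap.ext h0)
  let M : Submodule ℂ H :=
    { carrier := {x | ∀ c : A, π a (π c x) = 0}
      add_mem' := fun hx hx' c => by simp [hx c, hx' c]
      zero_mem' := fun c => by simp
      smul_mem' := fun r x hx c => by simp [hx c] }
  have hcl : IsClosed (M : Set H) := by
    have : (M : Set H) = ⋂ c : A, {x | π a (π c x) = 0} := by
      ext x; simp [M]
    rw [this]
    exact isClosed_iInter fun c => isClosed_eq (by fun_prop) continuous_const
  have hinv : ∀ d : A, ∀ x ∈ M, π d x ∈ M := by
    intro d x hx c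
    have := hx (c * d)
    simpa [map_mul] using this
  have hyM : π b y ∈ M := by
    intro c
    have := congrArg (fun T : H →L[ℂ] H => T y) (h c)
    simpa [map_mul] using this
  rcases hπ.eq_bot_or_eq_top M hcl hinv with hM | hM
  · rw [hM, Submodule.mem_bot] at hyM
    exact hy hyM
  · apply ha
    ext x
    have hx : x ∈ M := by rw [hM]; trivial
    simpa using hx 1

/-- The hull-kernel (Jacobson) topology: the closed sets are the hulls `{P | F ⊆ P}` of subsets
(equivalently, of ideals) `F` of `A`. -/
instance (A : Type u) [CStarAlgebra A] : TopologicalSpace (PrimitiveSpectrum A) where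
  IsOpen U := ∃ F : Set A, U = {P | ∃ a ∈ F, a ∉ P.1}
  isOpen_univ := ⟨{1}, by
    symm
    rw [Set.eq_univ_iff_forall]
    rintro ⟨P, H, _, _, _, π, hπ, rfl⟩
    refine ⟨1, rfl, ?_⟩
    have := hπ.nontrivial
    simp [RingHom.mem_ker]⟩
  isOpen_inter := by
    rintro _ _ ⟨F, rfl⟩ ⟨G, rfl⟩
    refine ⟨{x | ∃ a ∈ F, ∃ b ∈ G, ∃ c, x = a * c * b}, ?_⟩
    ext P
    constructor
    · rintro ⟨⟨a, ha, haP⟩, ⟨b, hb, hbP⟩⟩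
      obtain ⟨c, hc⟩ := P.2.exists_mul_mul_notMem haP hbP
      exact ⟨_, ⟨a, ha, b, hb, c, rfl⟩, hc⟩
    · rintro ⟨_, ⟨a, ha, b, hb, c, rfl⟩, hc⟩
      refine ⟨⟨a, ha, fun h => hc ?_⟩, ⟨b, hb, fun h => hc (P.1.mul_mem_left _ h)⟩⟩
      obtain ⟨P, H, _, _, _, π, hπ, rfl⟩ := P
      simp only [RingHom.mem_ker] at h ⊢
      simp [map_mul, h]
  isOpen_sUnion := by
    intro 𝒮 h
    refine ⟨{a | {P : PrimitiveSpectrum A | a ∉ P.1} ⊆ ⋃₀ 𝒮}, ?_⟩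
    ext P
    constructor
    · rintro ⟨U, hU, hP⟩
      obtain ⟨F, rfl⟩ := h U hU
      obtain ⟨a, ha, haP⟩ := hP
      exact ⟨a, fun Q hQ => ⟨_, hU, a, ha, hQ⟩, haP⟩
    · rintro ⟨a, ha, haP⟩
      exact ha haP

/-- `Prim_d A`: the primitive ideals that are kernels of `d`-dimensional irreducible
representations. As a space it carries the topology induced by `Prim A`. -/
def primOfDim (A : Type u) [CStarAlgebra A] (d : ℕ) : Set (PrimitiveSpectrum A) :=
  {P | ∃ (H : Type u) (_ : NormedAddCommGroup H) (_ : InnerProductSpace ℂ H) (_ : CompleteSpace H)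
    (π : A →⋆ₐ[ℂ] (H →L[ℂ] H)), IsIrreducibleRep π ∧ FiniteDimensional ℂ H ∧
      Module.finrank ℂ H = d ∧ RingHom.ker π = P.1}

/-- The dimension ratio of a subhomogeneous C⋆-algebra: the maximum of `dim (Prim_d A) / d` over the
dimensions `d` of the irreducible representations of `A`. -/
def dimRatio (A : Type u) [CStarAlgebra A] : ℝ≥0∞ :=
  ⨆ (d : ℕ) (_ : (primOfDim A d).Nonempty), (coveringDim (primOfDim A d) : ℝ≥0∞) / d

/-! ### The (spatial) tensor product of unital C⋆-algebras -/

/-- The states of `A`, i.e. the positive linear functionals `φ` with `φ 1 = 1`; here `A` carries its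
usual order, for which the positive elements are the self-adjoint ones with spectrum in `[0, ∞)`. -/
def CStarState (A : Type u) [CStarAlgebra A] : Type u :=
  letI := CStarAlgebra.spectralOrder A
  {φ : A →ₚ[ℂ] ℂ // φ 1 = 1}

namespace CStarState

variable {A : Type u} [CStarAlgebra A]

/-- The Hilbert space of the GNS representation of a state. -/
def Space (φ : CStarState A) : Type u :=
  letI := CStarAlgebra.spectralOrder A
  haveI := CStarAlgebra.spectralOrderedRing A
  φ.1.GNS

instance (φ : CStarState A) : NormedAddCommGroup φ.Space :=
  letI := CStarAlgebra.spectralOrder A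
  haveI := CStarAlgebra.spectralOrderedRing A
  inferInstanceAs (NormedAddCommGroup φ.1.GNS)

instance (φ : CStarState A) : InnerProductSpace ℂ φ.Space :=
  letI := CStarAlgebra.spectralOrder A
  haveI := CStarAlgebra.spectralOrderedRing A
  inferInstanceAs (InnerProductSpace ℂ φ.1.GNS)

instance (φ : CStarState A) : CompleteSpace φ.Space :=
  letI := CStarAlgebra.spectralOrder A
  haveI := CStarAlgebra.spectralOrderedRing A
  inferInstanceAs (CompleteSpace φ.1.GNS)

/-- The GNS representation of a state. -/
def rep (φ : CStarState A) : A →⋆ₐ[ℂ] (φ.Space →L[ℂ] φ.Space) :=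
  letI := CStarAlgebra.spectralOrder A
  haveI := CStarAlgebra.spectralOrderedRing A
  φ.1.gnsStarAlgHom

instance (φ : CStarState A) : Nontrivial φ.Space := by
  let _ := CStarAlgebra.spectralOrder A
  have := CStarAlgebra.spectralOrderedRing A
  refine ⟨⟨((φ.1.toPreGNS 1 : φ.1.PreGNS) : φ.1.GNS), (0 : φ.1.GNS), fun h => ?_⟩⟩
  have h1 := congrArg (fun x : φ.1.GNS => ‖x‖) h
  simp only [UniformSpace.Completion.norm_coe, norm_zero] at h1
  have h2 := φ.1.preGNS_norm_sq (φ.1.toPreGNS 1)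
  rw [h1] at h2
  simp [φ.2] at h2

end CStarState

/-- The tensor product of two Hilbert spaces. -/
abbrev HilbertTensor (H : Type*) (K : Type*) [NormedAddCommGroup H] [InnerProductSpace ℂ H]
    [NormedAddCommGroup K] [InnerProductSpace ℂ K] : Type _ :=
  UniformSpace.Completion (H ⊗[ℂ] K)

/-- The tensor product `T ⊗ U` of two bounded operators, as an operator on the Hilbert space
tensor product. -/
def opTensor {H : Type*} {K : Type*} [NormedAddCommGroup H] [InnerProductSpace ℂ H]
    [NormedAddCommGroup K] [InnerProductSpace ℂ K] (T : H →L[ℂ] H) (U : K →L[ℂ] K) :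
    HilbertTensor H K →L[ℂ] HilbertTensor H K :=
  (TensorProduct.mapL T U).completion

instance (H : Type*) (K : Type*) [NormedAddCommGroup H] [InnerProductSpace ℂ H]
    [NormedAddCommGroup K] [InnerProductSpace ℂ K] [Nontrivial H] [Nontrivial K] :
    Nontrivial (HilbertTensor H K) := by
  obtain ⟨x, hx⟩ := exists_ne (0 : H)
  obtain ⟨y, hy⟩ := exists_ne (0 : K)
  refine ⟨⟨((x ⊗ₜ[ℂ] y : H ⊗[ℂ] K) : HilbertTensor H K), 0, fun h => ?_⟩⟩
  have := congrArg norm h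
  simp [hx, hy] at this

theorem norm_opTensor_le {H : Type*} {K : Type*} [NormedAddCommGroup H] [InnerProductSpace ℂ H]
    [NormedAddCommGroup K] [InnerProductSpace ℂ K] (T : H →L[ℂ] H) (U : K →L[ℂ] K) :
    ‖opTensor T U‖ ≤ ‖T‖ * ‖U‖ := by
  refine ContinuousLinearMap.opNorm_le_bound _ (by positivity) fun x => ?_
  induction x using UniformSpace.Completion.induction_on with
  | hp => exact isClosed_le (by fun_prop) (by fun_prop)
  | ih x =>
    simp only [opTensor, ContinuousLinearMap.completion_apply_coe, UniformSpace.Completion.norm_coe]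
    exact (ContinuousLinearMap.le_opNorm _ _).trans
      (mul_le_mul_of_nonneg_right (TensorProduct.norm_mapL_le T U) (norm_nonneg _))

/-- The `ℓ^∞`-product of a family of C⋆-algebras, with its pointwise operations and the supremum
norm, is a C⋆-algebra. -/
@[reducible] def cstarAlgebraLpInfty {I : Type*} (A : I → Type*) [∀ i, CStarAlgebra (A i)]
    [∀ i, Nontrivial (A i)] : CStarAlgebra (lp A ∞) where

/-- The C⋆-algebra of bounded operators on the tensor product of the GNS spaces of two states. -/
def GNSTensorOp {C : Type u} {S : Type v} [CStarAlgebra C] [CStarAlgebra S] (φ : CStarState C)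
    (ψ : CStarState S) : Type (max u v) :=
  HilbertTensor φ.Space ψ.Space →L[ℂ] HilbertTensor φ.Space ψ.Space

instance {C : Type u} {S : Type v} [CStarAlgebra C] [CStarAlgebra S] (φ : CStarState C)
    (ψ : CStarState S) : CStarAlgebra (GNSTensorOp φ ψ) :=
  inferInstanceAs
    (CStarAlgebra (HilbertTensor φ.Space ψ.Space →L[ℂ] HilbertTensor φ.Space ψ.Space))

instance {C : Type u} {S : Type v} [CStarAlgebra C] [CStarAlgebra S] (φ : CStarState C)
    (ψ : CStarState S) : Nontrivial (GNSTensorOp φ ψ) :=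
  inferInstanceAs (Nontrivial (HilbertTensor φ.Space ψ.Space →L[ℂ] HilbertTensor φ.Space ψ.Space))

/-- The C⋆-algebra of all bounded families `(T φ ψ)` with `T φ ψ` an operator on the tensor product
of the GNS spaces of the states `φ` of `C` and `ψ` of `S`. -/
abbrev GNSTensorProd (C : Type u) (S : Type v) [CStarAlgebra C] [CStarAlgebra S] : Type (max u v) :=
  lp (fun p : CStarState C × CStarState S => GNSTensorOp p.1 p.2) ∞

instance (C : Type u) (S : Type v) [CStarAlgebra C] [CStarAlgebra S] :
    CStarAlgebra (GNSTensorProd C S) :=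
  cstarAlgebraLpInfty _

/-- The elementary tensor `c ⊗ s`, acting as `π_φ(c) ⊗ π_ψ(s)` for all states `φ` and `ψ`. -/
def elemTensor {C : Type u} {S : Type v} [CStarAlgebra C] [CStarAlgebra S] (c : C) (s : S) :
    GNSTensorProd C S :=
  ⟨fun p => opTensor (p.1.rep c) (p.2.rep s), memℓp_infty ⟨‖c‖ * ‖s‖, by
    rintro _ ⟨p, rfl⟩
    exact (norm_opTensor_le _ _).trans (mul_le_mul (NonUnitalStarAlgHom.norm_apply_le _ c)
      (NonUnitalStarAlgHom.norm_apply_le _ s) (norm_nonneg _) (norm_nonneg _))⟩⟩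

/-- The elementary tensors generate the spatial tensor product as a C⋆-algebra. -/
def spatialTensor (C : Type u) (S : Type v) [CStarAlgebra C] [CStarAlgebra S] :
    StarSubalgebra ℂ (GNSTensorProd C S) :=
  (StarAlgebra.adjoin ℂ {x | ∃ (c : C) (s : S), x = elemTensor c s}).topologicalClosure

/-- The tensor product `C ⊗ S` of unital C⋆-algebras: the completion of the algebraic tensor product
in the spatial (minimal) norm `‖x‖ = sup ‖(π_φ ⊗ π_ψ)(x)‖` over the GNS representations of the states
`φ` of `C` and `ψ` of `S`, that is, the C⋆-algebra generated by the elementary tensors in the tensor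
product of the universal representations. -/
def CStarTensor (C : Type u) (S : Type v) [CStarAlgebra C] [CStarAlgebra S] : Type (max u v) :=
  spatialTensor C S

instance (C : Type u) (S : Type v) [CStarAlgebra C] [CStarAlgebra S] :
    CStarAlgebra (CStarTensor C S) :=
  StarSubalgebra.cstarAlgebra (spatialTensor C S)
    (h_closed := StarSubalgebra.isClosed_topologicalClosure _)

end

/-
An irreducible representation `σ` of `C ⊗ S` whose dimension is finite, or whose factors are
subhomogeneous, restricts to factor representations of `C` and of `S`. These are multiples of
irreducible representations of dimensions `k` and `l` with kernels `P` and `Q`, so `σ` has dimension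
`k l` and its kernel is determined by `P` and `Q`. Hence `C ⊗ S` is subhomogeneous, and
`Prim_d (C ⊗ S)` is the disjoint union of the images of injections
`Φ : Prim_k C × Prim_l S → Prim_d (C ⊗ S)`, `k l = d`.

To see that `Φ` is continuous, lift it to representations on fixed Hilbert spaces. The
representations on `ℂ^d` with the topology of pointwise norm convergence form a compact space, in
which the irreducible ones are an open set. The map from these onto `Prim_d A` is proper: if the
intersection of the kernels over a compact set of representations is contained in the kernel of an
irreducible `σ`, then so is one of these kernels, because `ker σ` is prime. Properness also makes
`Prim_d A` locally compact and Hausdorff, and σ-compact if `A` is separable. So `Prim_d (C ⊗ S)` is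
a countable union of homeomorphic images of products of compact sets, and the countable sum theorem
together with `dim (X × Y) ≤ dim X + dim Y` for compact Hausdorff spaces yields `k` and `l` with
`k l = d` and `dim Prim_d (C ⊗ S) ≤ dim Prim_k C + dim Prim_l S`. Divide by `k l`.
-/

noncomputable section

/-! ### Covering dimension -/

section CoveringDimension

open Set

section Refinement

variable {X ι κ : Type*} [TopologicalSpace X]

theorem exists_refinement_of_refinement {U : ι → Set X} {V : κ → Set X} (hVo : ∀ j, IsOpen (V j))
    (hVc : ⋃ j, V j = univ) (hVU : ∀ j, ∃ i, V j ⊆ U i) {N : ℕ∞}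
    (hVN : ∀ x, {j | x ∈ V j}.encard ≤ N) :
    ∃ W : ι → Set X, (∀ i, IsOpen (W i)) ∧ ⋃ i, W i = univ ∧ (∀ i, W i ⊆ U i) ∧
      ∀ x, {i | x ∈ W i}.encard ≤ N := by
  choose f hf using hVU
  refine ⟨fun i => ⋃ j : f ⁻¹' {i}, V j, fun i => isOpen_iUnion fun j => hVo j,
    iUnion_eq_univ_iff.2 fun x => ?_, ?_, fun x => ?_⟩
  · obtain ⟨j, hj⟩ := iUnion_eq_univ_iff.1 hVc x
    exact ⟨f j, mem_iUnion.2 ⟨⟨j, rfl⟩, hj⟩⟩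
  · exact fun i => iUnion_subset fun ⟨j, hj⟩ => hj.subst (motive := fun i => V j ⊆ U i) (hf j)
  · have hsub : {i | x ∈ ⋃ j : f ⁻¹' {i}, V j} ⊆ f '' {j | x ∈ V j} := fun i hi => by
      obtain ⟨⟨j, hj⟩, hx⟩ := mem_iUnion.1 hi
      exact ⟨j, hx, hj⟩
    exact (encard_le_encard hsub).trans ((encard_image_le _ _).trans (hVN x))

theorem CoveringDimLE.exists_refinement [Finite ι] {n : ℕ} (h : CoveringDimLE X n) {U : ι → Set X}
    (hU : ∀ i, IsOpen (U i)) (hc : ⋃ i, U i = univ) :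
    ∃ V : ι → Set X, (∀ i, IsOpen (V i)) ∧ ⋃ i, V i = univ ∧ (∀ i, V i ⊆ U i) ∧
      ∀ x, {i | x ∈ V i}.encard ≤ n + 1 := by
  obtain ⟨𝒱, -, h𝒱o, h𝒱c, h𝒱r, h𝒱n⟩ := h (range U) (finite_range U)
    (forall_mem_range.2 hU) (by rw [sUnion_range, hc])
  refine exists_refinement_of_refinement (V := ((↑) : 𝒱 → Set X)) (fun V => h𝒱o V V.2)
    (by rw [← sUnion_eq_iUnion, h𝒱c]) (fun V => ?_) fun x => ?_
  · simpa only [exists_range_iff] using h𝒱r V V.2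
  · have himage : Subtype.val '' {V : 𝒱 | x ∈ V.1} = {V ∈ 𝒱 | x ∈ V} := by
      ext V
      simp [and_comm]
    rw [← Subtype.val_injective.encard_image, himage]
    exact h𝒱n x

theorem coveringDimLE_of_forall_fin {n : ℕ}
    (h : ∀ (k : ℕ) (U : Fin k → Set X), (∀ i, IsOpen (U i)) → ⋃ i, U i = univ →
      ∃ V : Fin k → Set X, (∀ i, IsOpen (V i)) ∧ ⋃ i, V i = univ ∧ (∀ i, V i ⊆ U i) ∧
        ∀ x, {i | x ∈ V i}.encard ≤ n + 1) :
    CoveringDimLE X n := by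
  intro 𝒰 hfin hop hcov
  obtain ⟨k, U, -, rfl⟩ := hfin.fin_param
  obtain ⟨V, hVo, hVc, hVU, hVn⟩ := h k U (forall_mem_range.1 hop) (by rw [← sUnion_range, hcov])
  refine ⟨range V, finite_range V, forall_mem_range.2 hVo, by rw [sUnion_range, hVc],
    forall_mem_range.2 fun i => ⟨U i, mem_range_self i, hVU i⟩, fun x => ?_⟩
  have hsub : {W ∈ range V | x ∈ W} ⊆ V '' {i | x ∈ V i} := by
    rintro _ ⟨⟨i, rfl⟩, hi⟩
    exact ⟨i, hi, rfl⟩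
  exact (encard_le_encard hsub).trans ((encard_image_le _ _).trans (hVn x))

end Refinement

theorem CoveringDimLE.of_isClosedEmbedding {X Y : Type*} [TopologicalSpace X]
    [TopologicalSpace Y] {f : X → Y} (hf : Topology.IsClosedEmbedding f) {n : ℕ}
    (h : CoveringDimLE Y n) : CoveringDimLE X n := by
  refine coveringDimLE_of_forall_fin fun k U hU hc => ?_
  choose O hO hOU using fun i => hf.isInducing.isOpen_iff.1 (hU i)
  obtain rfl : (fun i => f ⁻¹' O i) = U := funext hOU
  obtain ⟨V, hVo, hVc, hVO, hVn⟩ := h.exists_refinement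
    (U := fun i : Option (Fin k) => i.elim (range f)ᶜ O)
    (Option.forall.2 ⟨hf.isClosed_range.isOpen_compl, hO⟩) (iUnion_eq_univ_iff.2 fun y => by
      by_cases hy : y ∈ range f
      · obtain ⟨x, rfl⟩ := hy
        obtain ⟨i, hi⟩ := iUnion_eq_univ_iff.1 hc x
        exact ⟨some i, hi⟩
      · exact ⟨none, hy⟩)
  refine ⟨fun i => f ⁻¹' V (some i), fun i => (hVo _).preimage hf.continuous,
    iUnion_eq_univ_iff.2 fun x => ?_, fun i => preimage_mono (hVO (some i)), fun x => ?_⟩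
  · obtain ⟨_ | i, hi⟩ := iUnion_eq_univ_iff.1 hVc (f x)
    · exact absurd (mem_range_self x) (hVO none hi)
    · exact ⟨i, hi⟩
  · rw [← (Option.some_injective _).encard_image]
    exact (encard_le_encard (image_subset_iff.2 fun i hi => hi)).trans (hVn (f x))

theorem CoveringDimLE.mono {X : Type*} [TopologicalSpace X] {m n : ℕ} (h : CoveringDimLE X m)
    (hmn : m ≤ n) : CoveringDimLE X n := by
  intro 𝒰 hfin hop hcov
  obtain ⟨𝒱, h𝒱, ho, hc, hr, hm⟩ := h 𝒰 hfin hop hcov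
  exact ⟨𝒱, h𝒱, ho, hc, hr, fun x => (hm x).trans (by gcongr)⟩

theorem coveringDimLE_iff {X : Type*} [TopologicalSpace X] {n : ℕ} :
    CoveringDimLE X n ↔ coveringDim X ≤ n := by
  refine ⟨fun h => iInf₂_le n h, fun h => ?_⟩
  by_contra hn
  have hlt : ((n + 1 : ℕ) : ℕ∞) ≤ coveringDim X := le_iInf₂ fun m hm => by
    by_contra! hmn
    exact hn (hm.mono (Nat.lt_succ_iff.1 (Nat.cast_lt.1 hmn)))
  exact absurd (Nat.cast_le.1 (hlt.trans h)) (Nat.not_succ_le_self n)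

theorem exists_open_swelling {X ι : Type*} [TopologicalSpace X] [NormalSpace X] [Finite ι]
    {E U : ι → Set X} (hE : ∀ i, IsClosed (E i)) (hU : ∀ i, IsOpen (U i)) (hEU : ∀ i, E i ⊆ U i)
    {n : ℕ} (hn : ∀ x, {i | x ∈ E i}.encard ≤ n) :
    ∃ V : ι → Set X, (∀ i, IsOpen (V i)) ∧ (∀ i, E i ⊆ V i) ∧ (∀ i, V i ⊆ U i) ∧
      ∀ x, {i | x ∈ V i}.encard ≤ n := by
  -- Each subfamily with more than `n` members has empty intersection; swell it separately.
  have swell : ∀ s : {s : Set ι // (n : ℕ∞) < s.encard}, ∃ W : s.1 → Set X,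
      (∀ i, IsOpen (W i)) ∧ (∀ i : s.1, E i ⊆ W i) ∧ ⋂ i, W i = ∅ := by
    rintro ⟨s, hs⟩
    obtain ⟨v, hv1, hv2, hv3⟩ := exists_iUnion_eq_closed_subset (u := fun i : s => (E i)ᶜ)
      (fun i => (hE i).isOpen_compl) (fun x => toFinite _) (iUnion_eq_univ_iff.2 fun x => by
        by_contra! hx
        have hsub : s ⊆ {i | x ∈ E i} := fun i hi => not_not.1 (hx ⟨i, hi⟩)
        exact (hs.trans_le (encard_le_encard hsub)).not_ge (hn x))
    refine ⟨fun i => (v i)ᶜ, fun i => (hv2 i).isOpen_compl,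
      fun i => subset_compl_comm.1 (hv3 i), ?_⟩
    rw [← compl_iUnion, hv1, compl_univ]
  choose W hW1 hW2 hW3 using swell
  refine ⟨fun i => U i ∩ ⋂ (s) (hi : i ∈ s.1), W s ⟨i, hi⟩,
    fun i => (hU i).inter (isOpen_iInter_of_finite fun s => isOpen_iInter_of_finite fun hi =>
      hW1 _ _), fun i => subset_inter (hEU i) (subset_iInter₂ fun s hi => hW2 s ⟨i, hi⟩),
    fun i => inter_subset_left, fun x => ?_⟩
  by_contra! hlt
  have hx : x ∈ ⋂ i, W ⟨_, hlt⟩ i := mem_iInter.2 fun i => mem_iInter₂.1 i.2.2 ⟨_, hlt⟩ i.2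
  exact (hW3 _).subset hx

theorem iUnion_iInter_eq_univ_of_antitone {X ι : Type*} [Finite ι]
    {V : ℕ → ι → Set X} (hV : ∀ i, Antitone fun k => V k i) (hc : ∀ k, ⋃ i, V k i = univ) :
    ⋃ i, ⋂ k, V k i = univ := by
  refine iUnion_eq_univ_iff.2 fun x => ?_
  by_contra! hx
  simp only [mem_iInter, not_forall] at hx
  choose k hk using hx
  obtain ⟨N, hN⟩ := (finite_range k).bddAbove
  obtain ⟨i, hi⟩ := iUnion_eq_univ_iff.1 (hc N) x
  exact hk i (hV i (hN (mem_range_self i)) hi)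

section SumTheorem

variable {X ι : Type*} [TopologicalSpace X]

theorem CoveringDimLE.exists_shrinking [NormalSpace X] [Finite ι] {F : Set X} (hF : IsClosed F)
    {n : ℕ} (h : CoveringDimLE F n) {U : ι → Set X} (hU : ∀ i, IsOpen (U i))
    (hc : ⋃ i, U i = univ) :
    ∃ V : ι → Set X, (∀ i, IsOpen (V i)) ∧ ⋃ i, V i = univ ∧ (∀ i, closure (V i) ⊆ U i) ∧
      ∀ x ∈ F, {i | x ∈ closure (V i)}.encard ≤ n + 1 := by
  obtain ⟨W, hW1, hW2, hW3, hW4⟩ := h.exists_refinement (U := fun i => (↑) ⁻¹' U i)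
    (fun i => (hU i).preimage continuous_subtype_val) (by rw [← preimage_iUnion, hc, preimage_univ])
  choose O hO hOW using fun i => isOpen_induced_iff.1 (hW1 i)
  obtain rfl : (fun i => Subtype.val ⁻¹' O i) = W := funext hOW
  obtain ⟨V, hV1, hV2, hV3⟩ := exists_iUnion_eq_closure_subset (u := fun i => U i ∩ (O i ∪ Fᶜ))
    (fun i => (hU i).inter ((hO i).union hF.isOpen_compl)) (fun x => toFinite _)
    (iUnion_eq_univ_iff.2 fun x => by
      by_cases hx : x ∈ F
      · obtain ⟨i, hi⟩ := iUnion_eq_univ_iff.1 hW2 ⟨x, hx⟩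
        exact ⟨i, hW3 i hi, Or.inl hi⟩
      · obtain ⟨i, hi⟩ := iUnion_eq_univ_iff.1 hc x
        exact ⟨i, hi, Or.inr hx⟩)
  refine ⟨V, hV2, hV1, fun i => (hV3 i).trans inter_subset_left, fun x hx => ?_⟩
  exact (encard_le_encard fun i hi => (hV3 i hi).2.resolve_right (not_not.2 hx)).trans (hW4 ⟨x, hx⟩)

theorem exists_shrinking_seq [NormalSpace X] [Finite ι] {F : ℕ → Set X} (hF : ∀ k, IsClosed (F k))
    {n : ℕ} (h : ∀ k, CoveringDimLE (F k) n) {U : ι → Set X} (hU : ∀ i, IsOpen (U i))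
    (hc : ⋃ i, U i = univ) :
    ∃ V : ℕ → ι → Set X, (∀ i, Antitone fun k => V k i) ∧ (∀ k, ⋃ i, V k i = univ) ∧
      (∀ k i, closure (V k i) ⊆ U i) ∧ (∀ i, ⋂ k, closure (V k i) = ⋂ k, V k i) ∧
      ∀ k, ∀ x ∈ F k, {i | x ∈ closure (V k i)}.encard ≤ n + 1 := by
  let T := {U : ι → Set X // (∀ i, IsOpen (U i)) ∧ ⋃ i, U i = univ}
  have shrink (k : ℕ) (U : T) : ∃ V : T, (∀ i, closure (V.1 i) ⊆ U.1 i) ∧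
      ∀ x ∈ F k, {i | x ∈ closure (V.1 i)}.encard ≤ n + 1 := by
    obtain ⟨V, h1, h2, h3, h4⟩ := (h k).exists_shrinking (hF k) U.2.1 U.2.2
    exact ⟨⟨V, h1, h2⟩, h3, h4⟩
  choose next hnext hnextF using shrink
  let V : ℕ → T := fun k => k.rec ⟨U, hU, hc⟩ next
  have hV (k i) : closure ((V (k + 1)).1 i) ⊆ (V k).1 i := hnext k (V k) i
  have hanti (i) : Antitone fun k => (V k).1 i :=
    antitone_nat_of_succ_le fun k => subset_closure.trans (hV k i)
  refine ⟨fun k => (V (k + 1)).1, fun i => (hanti i).comp_monotone fun _ _ => Nat.succ_le_succ,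
    fun k => (V (k + 1)).2.2, fun k i => (hV k i).trans (hanti i (Nat.zero_le k)),
    fun i => subset_antisymm (subset_iInter fun k => ?_) (iInter_mono fun k => subset_closure),
    fun k => hnextF k (V k)⟩
  exact (iInter_subset _ (k + 1)).trans (hV (k + 1) i)

theorem CoveringDimLE.of_iUnion [NormalSpace X] {F : ℕ → Set X} (hF : ∀ k, IsClosed (F k))
    (hFX : ⋃ k, F k = univ) {n : ℕ} (h : ∀ k, CoveringDimLE (F k) n) : CoveringDimLE X n := by
  refine coveringDimLE_of_forall_fin fun k U hU hc => ?_
  obtain ⟨V, hanti, hVc, hVU, hVV, hVF⟩ := exists_shrinking_seq hF h hU hc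
  obtain ⟨W, hW1, hW2, hW3, hW4⟩ := exists_open_swelling
    (E := fun i => ⋂ k, closure (V k i)) (n := n + 1)
    (fun i => isClosed_iInter fun k => isClosed_closure) hU
    (fun i => (iInter_subset _ 0).trans (hVU 0 i)) (fun x => by
      obtain ⟨k, hk⟩ := iUnion_eq_univ_iff.1 hFX x
      have hsub : {i | x ∈ ⋂ k, closure (V k i)} ⊆ {i | x ∈ closure (V k i)} :=
        fun i hi => mem_iInter.1 hi k
      exact_mod_cast (encard_le_encard hsub).trans (hVF k x hk))
  simp only [hVV] at hW2
  exact ⟨W, hW1, univ_subset_iff.1 (iUnion_iInter_eq_univ_of_antitone hanti hVc ▸ iUnion_mono hW2),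
    hW3, by exact_mod_cast hW4⟩

end SumTheorem

/-- `G` is a disjoint open refinement of the family `U`: a union of pairwise disjoint open sets
`D i ⊆ U i`. (It need not cover the space.) -/
def IsDisjointlyRefining {X ι : Type*} [TopologicalSpace X] (U : ι → Set X) (G : Set X) : Prop :=
  ∃ D : ι → Set X, (∀ i, IsOpen (D i)) ∧ Pairwise (Function.onFun Disjoint D) ∧
    (∀ i, D i ⊆ U i) ∧ ⋃ i, D i = G

namespace IsDisjointlyRefining

variable {X ι : Type*} [TopologicalSpace X] {U : ι → Set X}

theorem isOpen {G : Set X} (h : IsDisjointlyRefining U G) : IsOpen G := by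
  obtain ⟨D, hD, -, -, rfl⟩ := h
  exact isOpen_iUnion hD

theorem mono {G G' : Set X} (h : IsDisjointlyRefining U G) (hG' : IsOpen G') (hGG' : G' ⊆ G) :
    IsDisjointlyRefining U G' := by
  obtain ⟨D, h1, h2, h3, rfl⟩ := h
  refine ⟨fun i => D i ∩ G', fun i => (h1 i).inter hG',
    fun i j hij => (h2 hij).mono inter_subset_left inter_subset_left,
    fun i => inter_subset_left.trans (h3 i), ?_⟩
  rw [← iUnion_inter, inter_eq_right.2 hGG']

theorem of_subset {G : Set X} {i : ι} (hG : IsOpen G) (h : G ⊆ U i) :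
    IsDisjointlyRefining U G := by
  refine ⟨fun j => {x ∈ G | j = i}, fun j => hG.inter isOpen_const, fun j k hjk => ?_, ?_, ?_⟩
  · exact disjoint_left.2 fun x hj hk => hjk (hj.2.trans hk.2.symm)
  · rintro j x ⟨hx, rfl⟩
    exact h hx
  · ext x
    simp

theorem iUnion {κ : Type*} {G : κ → Set X} (h : ∀ k, IsDisjointlyRefining U (G k))
    (hd : Pairwise (Function.onFun Disjoint G)) : IsDisjointlyRefining U (⋃ k, G k) := by
  choose D h1 h2 h3 h4 using h
  refine ⟨fun i => ⋃ k, D k i, fun i => isOpen_iUnion fun k => h1 k i, fun i j hij => ?_,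
    fun i => iUnion_subset fun k => h3 k i, ?_⟩
  · simp only [Function.onFun, disjoint_iUnion_left, disjoint_iUnion_right]
    intro k l
    by_cases hkl : l = k
    · subst hkl; exact h2 l hij
    · exact (hd hkl).mono (h4 l ▸ subset_iUnion _ _) (h4 k ▸ subset_iUnion _ _)
  · rw [iUnion_comm]
    exact iUnion_congr h4

end IsDisjointlyRefining

/-- The points at which the functions `f i` with `i ∈ s` are positive and exceed all the others. -/
def dominanceCell {X ι : Type*} (f : ι → X → ℝ) (s : Set ι) : Set X :=
  {x | ∀ i ∈ s, 0 < f i x ∧ ∀ j ∉ s, f j x < f i x}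

theorem isOpen_dominanceCell {X ι : Type*} [TopologicalSpace X] [Finite ι] {f : ι → X → ℝ}
    (hf : ∀ i, Continuous (f i)) (s : Set ι) : IsOpen (dominanceCell f s) := by
  simp only [dominanceCell, ofPred_forall, ofPred_and]
  exact isOpen_iInter_of_finite fun i => isOpen_iInter_of_finite fun _ =>
    (isOpen_lt continuous_const (hf i)).inter <| isOpen_iInter_of_finite fun j =>
      isOpen_iInter_of_finite fun _ => isOpen_lt (hf j) (hf i)

theorem disjoint_dominanceCell {X ι : Type*} (f : ι → X → ℝ) {s t : Set ι} (hst : ¬ s ⊆ t)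
    (hts : ¬ t ⊆ s) : Disjoint (dominanceCell f s) (dominanceCell f t) := by
  obtain ⟨i, his, hit⟩ := not_subset.1 hst
  obtain ⟨j, hjt, hjs⟩ := not_subset.1 hts
  exact disjoint_left.2 fun x hxs hxt => lt_asymm ((hxs i his).2 j hjs) ((hxt j hjt).2 i hit)

theorem CoveringDimLE.exists_disjointlyRefining_cover {X ι : Type*} [TopologicalSpace X]
    [NormalSpace X] [Finite ι] {n : ℕ} (h : CoveringDimLE X n) {U : ι → Set X}
    (hU : ∀ i, IsOpen (U i)) (hc : ⋃ i, U i = univ) :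
    ∃ G : Fin (n + 1) → Set X, (∀ c, IsDisjointlyRefining U (G c)) ∧ ⋃ c, G c = univ := by
  obtain ⟨V, hVo, hVc, hVU, hVn⟩ := h.exists_refinement hU hc
  obtain ⟨f, hf⟩ := PartitionOfUnity.exists_isSubordinate_of_locallyFinite isClosed_univ V hVo
    (locallyFinite_of_finite V) hVc.ge
  have hfV (i x) (hx : 0 < f i x) : x ∈ V i :=
    hf i (subset_tsupport _ (Function.mem_support.2 hx.ne'))
  refine ⟨fun c => ⋃ s : {s : Set ι // s.ncard = c + 1}, dominanceCell (fun i => f i) s.1,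
    fun c => .iUnion (fun s => ?_) fun s t hst => ?_, iUnion_eq_univ_iff.2 fun x => ?_⟩
  · obtain ⟨i, hi⟩ : s.1.Nonempty := nonempty_of_ncard_ne_zero (by rw [s.2]; omega)
    exact .of_subset (isOpen_dominanceCell (fun i => (f i).continuous) _)
      fun x hx => hVU i (hfV i x (hx i hi).1)
  · exact disjoint_dominanceCell _
      (fun hsub => hst (Subtype.ext (eq_of_subset_of_ncard_le hsub (by rw [s.2, t.2]))))
      fun hsub => hst (Subtype.ext (eq_of_subset_of_ncard_le hsub (by rw [s.2, t.2])).symm)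
  · let s : Set ι := {i | 0 < f i x}
    have hle : s.ncard ≤ n + 1 := by
      have hsub : s ⊆ {i | x ∈ V i} := fun i hi => hfV i x hi
      have hsn := (encard_le_encard hsub).trans (hVn x)
      rw [← (toFinite s).cast_ncard_eq] at hsn
      exact_mod_cast hsn
    have hpos : 0 < s.ncard := (ncard_pos (toFinite s)).2 (f.exists_pos (mem_univ x))
    exact ⟨⟨s.ncard - 1, by omega⟩, mem_iUnion.2 ⟨⟨s, (Nat.sub_add_cancel hpos).symm⟩,
      fun i hi => ⟨hi, fun j hj => (not_lt.1 hj).trans_lt hi⟩⟩⟩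

theorem exists_shrinking_of_ncard_le {X κ : Type*} [TopologicalSpace X] [NormalSpace X] [Finite κ]
    {G : κ → Set X} (hG : ∀ c, IsOpen (G c)) {n : ℕ} (hn : ∀ x, {c | x ∉ G c}.ncard ≤ n) :
    ∃ W : κ → Set X, (∀ c, IsOpen (W c)) ∧ (∀ c, closure (W c) ⊆ G c) ∧
      ∀ x, {c | x ∉ W c}.ncard ≤ n := by
  obtain ⟨V, h1, h2, -, h4⟩ := exists_open_swelling (E := fun c => (G c)ᶜ) (U := fun _ => univ)
    (fun c => (hG c).isClosed_compl) (fun _ => isOpen_univ) (fun _ => subset_univ _) (n := n)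
    (fun x => by
      rw [← (toFinite {i | x ∈ (G i)ᶜ}).cast_ncard_eq]
      exact_mod_cast hn x)
  choose W hW1 hW2 hW3 using fun c => normal_exists_closure_subset (h1 c).isClosed_compl (hG c)
    (compl_subset_comm.1 (h2 c))
  refine ⟨W, hW1, hW3, fun x => ?_⟩
  have hVn := h4 x
  rw [← (toFinite {i | x ∈ V i}).cast_ncard_eq] at hVn
  have hsub : {c | x ∉ W c} ⊆ {c | x ∈ V c} := fun c hc => by_contra fun hx => hc (hW2 c hx)
  exact (ncard_le_ncard hsub (toFinite _)).trans (by exact_mod_cast hVn)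

theorem exists_disjointlyRefining_of_ncard_eq {X ι κ : Type*} [TopologicalSpace X] [NormalSpace X]
    [Finite κ] {U : ι → Set X} {G : κ → Set X} (hG : ∀ c, IsDisjointlyRefining U (G c)) {n : ℕ}
    (hn : ∀ x, {c | x ∉ G c}.ncard ≤ n) (hκ : n < Nat.card κ) :
    ∃ G', IsDisjointlyRefining U G' ∧ ∀ x, {c | x ∉ G c}.ncard = n → x ∈ G' := by
  obtain ⟨W, hW1, hW2, hW3⟩ := exists_shrinking_of_ncard_le (fun c => (hG c).isOpen) hn
  let O : Set κ → Set X := fun s => (⋂ c ∈ sᶜ, W c) ∩ ⋂ c ∈ s, (closure (W c))ᶜ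
  have hO (s) : IsOpen (O s) :=
    (isOpen_iInter_of_finite fun c => isOpen_iInter_of_finite fun _ => hW1 c).inter
      (isOpen_iInter_of_finite fun c => isOpen_iInter_of_finite fun _ =>
        isClosed_closure.isOpen_compl)
  refine ⟨⋃ s : {s : Set κ // s.ncard = n}, O s.1, .iUnion (fun s => ?_) fun s t hst => ?_,
    fun x hx => mem_iUnion.2 ⟨⟨_, hx⟩, ?_⟩⟩
  · obtain ⟨c, hc⟩ : ∃ c, c ∉ s.1 := by
      by_contra! hall
      rw [← s.2, eq_univ_of_forall hall, ncard_univ] at hκ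
      exact hκ.false
    exact (hG c).mono (hO _) fun x hx => hW2 c (subset_closure (mem_iInter₂.1 hx.1 c hc))
  · obtain ⟨c, hcs, hct⟩ : ∃ c ∈ s.1, c ∉ t.1 := not_subset.1 fun hsub =>
      hst (Subtype.ext (eq_of_subset_of_ncard_le hsub (by rw [s.2, t.2])))
    exact disjoint_left.2 fun x hxs hxt =>
      mem_iInter₂.1 hxs.2 c hcs (subset_closure (mem_iInter₂.1 hxt.1 c hct))
  · have hWG : {c | x ∉ G c} = {c | x ∉ W c} := eq_of_subset_of_ncard_le
      (fun c hc hxW => hc (hW2 c (subset_closure hxW))) (hx ▸ hW3 x)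
    exact ⟨mem_iInter₂.2 fun c hc => by_contra fun hxW => hc (hWG.superset hxW),
      mem_iInter₂.2 fun c hc hxW => hc (hW2 c hxW)⟩

theorem exists_disjointlyRefining_succ {X ι : Type*} [TopologicalSpace X] [NormalSpace X]
    {U : ι → Set X} {N : ℕ} {G : Fin N → Set X} (hG : ∀ c, IsDisjointlyRefining U (G c)) {n : ℕ}
    (hn : ∀ x, {c | x ∉ G c}.ncard ≤ n) (hN : n < N) :
    ∃ G' : Fin (N + 1) → Set X, (∀ c, IsDisjointlyRefining U (G' c)) ∧
      ∀ x, {c | x ∉ G' c}.ncard ≤ n := by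
  obtain ⟨G₀, hG₀, hmem⟩ := exists_disjointlyRefining_of_ncard_eq hG hn (by rwa [Nat.card_fin])
  refine ⟨Fin.cons G₀ G, Fin.cases hG₀ hG, fun x => ?_⟩
  have himage : (Fin.succ '' {c | x ∉ G c}).ncard = {c | x ∉ G c}.ncard :=
    ncard_image_of_injective _ (Fin.succ_injective N)
  by_cases hx : x ∈ G₀
  · have hsub : {c | x ∉ (Fin.cons G₀ G : Fin (N + 1) → Set X) c} ⊆ Fin.succ '' {c | x ∉ G c} :=
      fun c => Fin.cases (fun h => absurd hx h) (fun c h => ⟨c, h, rfl⟩) c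
    exact (ncard_le_ncard hsub (toFinite _)).trans (himage ▸ hn x)
  · have hsub : {c | x ∉ (Fin.cons G₀ G : Fin (N + 1) → Set X) c} ⊆
        insert 0 (Fin.succ '' {c | x ∉ G c}) :=
      fun c => Fin.cases (fun _ => Or.inl rfl) (fun c h => Or.inr ⟨c, h, rfl⟩) c
    refine (ncard_le_ncard hsub (toFinite _)).trans ((ncard_insert_le _ _).trans ?_)
    rw [himage]
    exact (hn x).lt_of_ne fun h => hx (hmem x h)

-- Ostrand's form of the dimension: beyond the first `n + 1` disjoint refinements, each further one
-- is chosen to contain the points that the earlier ones miss exactly `n` times.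
theorem CoveringDimLE.exists_disjointlyRefining {X ι : Type*} [TopologicalSpace X] [NormalSpace X]
    [Finite ι] {n : ℕ} (h : CoveringDimLE X n) {U : ι → Set X} (hU : ∀ i, IsOpen (U i))
    (hc : ⋃ i, U i = univ) {N : ℕ} (hN : n + 1 ≤ N) :
    ∃ G : Fin N → Set X, (∀ c, IsDisjointlyRefining U (G c)) ∧
      ∀ x, {c | x ∉ G c}.ncard ≤ n := by
  induction N, hN using Nat.le_induction with
  | base =>
    obtain ⟨G, hG, hGc⟩ := h.exists_disjointlyRefining_cover hU hc
    refine ⟨G, hG, fun x => Nat.le_of_lt_succ ?_⟩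
    obtain ⟨c, hc⟩ := iUnion_eq_univ_iff.1 hGc x
    have hlt : {c | x ∉ G c} ⊂ univ := ssubset_univ_iff.2 fun heq => (heq ▸ mem_univ c) hc
    simpa [ncard_univ] using ncard_lt_ncard hlt (toFinite _)
  | succ N hN ih =>
    obtain ⟨G, hG, hGn⟩ := ih
    exact exists_disjointlyRefining_succ hG hGn hN

theorem exists_prod_refinement {X Y ι : Type*} [TopologicalSpace X] [TopologicalSpace Y]
    [CompactSpace X] [CompactSpace Y] [R1Space X] [R1Space Y] {O : ι → Set (X × Y)}
    (hO : ∀ i, IsOpen (O i)) (hc : ⋃ i, O i = univ) :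
    ∃ (s : Finset X) (t : Finset Y) (U : X → Set X) (V : Y → Set Y),
      (∀ x, IsOpen (U x)) ∧ (∀ y, IsOpen (V y)) ∧ ⋃ x : s, U x = univ ∧ ⋃ y : t, V y = univ ∧
      ∀ x y, ∃ i, U x ×ˢ V y ⊆ O i := by
  let _ : UniformSpace X := uniformSpaceOfCompactR1
  let _ : UniformSpace Y := uniformSpaceOfCompactR1
  obtain ⟨W, hW, hWO⟩ := lebesgue_number_lemma isCompact_univ hO hc.ge
  obtain ⟨A, hA, B, hB, hAB⟩ := entourageProd_subset hW
  obtain ⟨s, -, hs⟩ := isCompact_univ.elim_nhds_subcover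
    (fun x : X => interior (UniformSpace.ball x A))
    fun x _ => interior_mem_nhds.2 (UniformSpace.ball_mem_nhds x hA)
  obtain ⟨t, -, ht⟩ := isCompact_univ.elim_nhds_subcover
    (fun y : Y => interior (UniformSpace.ball y B))
    fun y _ => interior_mem_nhds.2 (UniformSpace.ball_mem_nhds y hB)
  refine ⟨s, t, fun x => interior (UniformSpace.ball x A),
    fun y => interior (UniformSpace.ball y B), fun _ => isOpen_interior, fun _ => isOpen_interior,
    ?_, ?_, fun x y => ?_⟩
  · simpa only [iUnion_subtype] using univ_subset_iff.1 hs
  · simpa only [iUnion_subtype] using univ_subset_iff.1 ht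
  · obtain ⟨i, hi⟩ := hWO (x, y) (mem_univ _)
    have hball : UniformSpace.ball x A ×ˢ UniformSpace.ball y B ⊆ O i := fun p hp => hi (hAB hp)
    exact ⟨i, (prod_mono interior_subset interior_subset).trans hball⟩

theorem exists_mem_and_mem_of_ncard_lt {X Y κ : Type*} [Finite κ] {G : κ → Set X} {G' : κ → Set Y}
    {x : X} {y : Y} (h : {c | x ∉ G c}.ncard + {c | y ∉ G' c}.ncard < Nat.card κ) :
    ∃ c, x ∈ G c ∧ y ∈ G' c := by
  by_contra! hno
  have hsub : (univ : Set κ) ⊆ {c | x ∉ G c} ∪ {c | y ∉ G' c} :=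
    fun c _ => or_iff_not_imp_left.2 fun hx => hno c (not_not.1 hx)
  have hle := (ncard_le_ncard hsub (toFinite _)).trans (ncard_union_le _ _)
  rw [ncard_univ] at hle
  omega

theorem CoveringDimLE.prod {X Y : Type*} [TopologicalSpace X] [TopologicalSpace Y]
    [CompactSpace X] [CompactSpace Y] [T2Space X] [T2Space Y] {n m : ℕ} (hX : CoveringDimLE X n)
    (hY : CoveringDimLE Y m) : CoveringDimLE (X × Y) (n + m) := by
  refine coveringDimLE_of_forall_fin fun k O hO hc => ?_
  obtain ⟨s, t, U, V, hU, hV, hUc, hVc, hUV⟩ := exists_prod_refinement hO hc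
  obtain ⟨G, hG, hGn⟩ := hX.exists_disjointlyRefining (U := fun x : s => U x) (fun x => hU x) hUc
    (N := n + m + 1) (by omega)
  obtain ⟨G', hG', hGn'⟩ := hY.exists_disjointlyRefining (U := fun y : t => V y) (fun y => hV y) hVc
    (N := n + m + 1) (by omega)
  choose D hD1 hD2 hD3 hD4 using hG
  choose D' hD1' hD2' hD3' hD4' using hG'
  refine exists_refinement_of_refinement
    (V := fun p : Fin (n + m + 1) × s × t => D p.1 p.2.1 ×ˢ D' p.1 p.2.2)
    (fun p => (hD1 _ _).prod (hD1' _ _)) (iUnion_eq_univ_iff.2 fun z => ?_) (fun p => ?_)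
    fun z => ?_
  · obtain ⟨c, hc1, hc2⟩ : ∃ c, z.1 ∈ G c ∧ z.2 ∈ G' c := exists_mem_and_mem_of_ncard_lt
      ((Nat.add_le_add (hGn z.1) (hGn' z.2)).trans_lt (by simp))
    rw [← hD4 c] at hc1
    rw [← hD4' c] at hc2
    obtain ⟨a, ha⟩ := mem_iUnion.1 hc1
    obtain ⟨b, hb⟩ := mem_iUnion.1 hc2
    exact ⟨(c, a, b), ha, hb⟩
  · obtain ⟨i, hi⟩ := hUV p.2.1 p.2.2
    exact ⟨i, (prod_mono (hD3 _ _) (hD3' _ _)).trans hi⟩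
  · have hinj : InjOn Prod.fst {p : Fin (n + m + 1) × s × t | z ∈ D p.1 p.2.1 ×ˢ D' p.1 p.2.2} := by
      rintro ⟨c, a, b⟩ ⟨ha, hb⟩ ⟨_, a', b'⟩ ⟨ha', hb'⟩ rfl
      have haa' : a = a' := by_contra fun hne => disjoint_left.1 (hD2 c hne) ha ha'
      have hbb' : b = b' := by_contra fun hne => disjoint_left.1 (hD2' c hne) hb hb'
      rw [haa', hbb']
    rw [← hinj.encard_image]
    refine (encard_le_encard (subset_univ _)).trans ?_
    rw [encard_univ, ENat.card_eq_coe_natCard]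
    simp

theorem CoveringDimLE.of_iUnion_countable {X ι : Type*} [TopologicalSpace X] [NormalSpace X]
    [Countable ι] {F : ι → Set X} (hF : ∀ i, IsClosed (F i)) (hFX : ⋃ i, F i = univ) {n : ℕ}
    (h : ∀ i, CoveringDimLE (F i) n) : CoveringDimLE X n := by
  rcases isEmpty_or_nonempty ι with _ | _
  · have : IsEmpty X := by rw [← univ_eq_empty_iff, ← hFX, iUnion_of_empty]
    exact fun 𝒰 hfin hop hc => ⟨𝒰, hfin, hop, hc, fun V hV => ⟨V, hV, subset_rfl⟩, isEmptyElim⟩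
  · obtain ⟨f, hf⟩ := exists_surjective_nat ι
    exact .of_iUnion (fun k => hF (f k)) (by rw [hf.iUnion_comp, hFX]) fun k => h (f k)

theorem CoveringDimLE.image {X Y : Type*} [TopologicalSpace X] [TopologicalSpace Y] [T2Space Y]
    {f : X → Y} (hf : Continuous f) (hinj : Function.Injective f) {K : Set X} (hK : IsCompact K)
    {n : ℕ} (h : CoveringDimLE K n) : CoveringDimLE (f '' K) n := by
  have := isCompact_iff_compactSpace.1 hK
  let e : K ≃ f '' K := Equiv.Set.image f K hinj
  have he : Continuous e := (hf.comp continuous_subtype_val).subtype_mk _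
  exact .of_isClosedEmbedding (he.homeoOfEquivCompactToT2 (f := e)).symm.isClosedEmbedding h

theorem CoveringDimLE.prod_set {X Y : Type*} [TopologicalSpace X] [TopologicalSpace Y] [T2Space X]
    [T2Space Y] {n m : ℕ} (hX : CoveringDimLE X n) (hY : CoveringDimLE Y m) {K : Set X}
    (hK : IsCompact K) {L : Set Y} (hL : IsCompact L) :
    CoveringDimLE (K ×ˢ L : Set (X × Y)) (n + m) := by
  have := isCompact_iff_compactSpace.1 hK
  have := isCompact_iff_compactSpace.1 hL
  have h : CoveringDimLE (K × L) (n + m) := .prod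
    (.of_isClosedEmbedding hK.isClosed.isClosedEmbedding_subtypeVal hX)
    (.of_isClosedEmbedding hL.isClosed.isClosedEmbedding_subtypeVal hY)
  exact .of_isClosedEmbedding (Homeomorph.Set.prod K L).isClosedEmbedding h

theorem exists_coveringDimLE_of_add_le {X Y : Type*} [TopologicalSpace X] [TopologicalSpace Y]
    {n : ℕ} (h : coveringDim X + coveringDim Y ≤ n) :
    ∃ a b, CoveringDimLE X a ∧ CoveringDimLE Y b ∧ a + b ≤ n := by
  obtain ⟨hX, hY⟩ := WithTop.add_ne_top.1 (ne_top_of_le_ne_top (ENat.natCast_ne_top n) h)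
  obtain ⟨a, ha⟩ := ENat.ne_top_iff_exists.1 hX
  obtain ⟨b, hb⟩ := ENat.ne_top_iff_exists.1 hY
  rw [← ha, ← hb] at h
  exact ⟨a, b, coveringDimLE_iff.2 ha.ge, coveringDimLE_iff.2 hb.ge, by exact_mod_cast h⟩

theorem CoveringDimLE.of_iUnion_range_prod {Z ι : Type*} [TopologicalSpace Z] [T2Space Z]
    [WeaklyLocallyCompactSpace Z] [Countable ι] {X Y : ι → Type*} [∀ i, TopologicalSpace (X i)]
    [∀ i, T2Space (X i)] [∀ i, SigmaCompactSpace (X i)] [∀ i, TopologicalSpace (Y i)]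
    [∀ i, T2Space (Y i)] [∀ i, SigmaCompactSpace (Y i)] {Φ : ∀ i, X i × Y i → Z}
    (hΦ : ∀ i, Continuous (Φ i)) (hinj : ∀ i, Function.Injective (Φ i))
    (hcov : ⋃ i, range (Φ i) = univ) {n : ℕ}
    (h : ∀ i, coveringDim (X i) + coveringDim (Y i) ≤ n) : CoveringDimLE Z n := by
  let K : ∀ j : ι × ℕ × ℕ, Set (X j.1 × Y j.1) := fun j =>
    compactCovering (X j.1) j.2.1 ×ˢ compactCovering (Y j.1) j.2.2
  have hK (j) : IsCompact (K j) :=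
    (isCompact_compactCovering _ _).prod (isCompact_compactCovering _ _)
  have hKcov : ⋃ j, Φ j.1 '' K j = univ := iUnion_eq_univ_iff.2 fun z => by
    obtain ⟨i, ⟨x, y⟩, rfl⟩ := iUnion_eq_univ_iff.1 hcov z
    obtain ⟨a, ha⟩ := exists_mem_compactCovering x
    obtain ⟨b, hb⟩ := exists_mem_compactCovering y
    exact ⟨(i, a, b), (x, y), ⟨ha, hb⟩, rfl⟩
  have : SigmaCompactSpace Z := by
    rw [← isSigmaCompact_univ_iff, ← hKcov]
    exact isSigmaCompact_iUnion _ fun j => ((hK j).image (hΦ j.1)).isSigmaCompact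
  refine .of_iUnion_countable (fun j => ((hK j).image (hΦ j.1)).isClosed) hKcov fun j => ?_
  obtain ⟨a, b, ha, hb, hab⟩ := exists_coveringDimLE_of_add_le (h j.1)
  exact (CoveringDimLE.image (hΦ j.1) (hinj j.1) (hK j) (ha.prod_set hb
    (isCompact_compactCovering _ _) (isCompact_compactCovering _ _))).mono hab

end CoveringDimension

/-! ### Pure states -/

section States

open Set

/-- The states of a C⋆-algebra, viewed inside the space of all functions with the topology of
pointwise convergence (the weak-⋆ topology). -/
def stateSet (A : Type*) [CStarAlgebra A] : Set (A → ℂ) :=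
  {f | IsLinearMap ℂ f ∧ (∀ a, 0 ≤ f (star a * a)) ∧ f 1 = 1}

variable {A : Type u} [CStarAlgebra A]

namespace CStarState

/-- The element of `CStarState A` given by a member of `stateSet A`. -/
def ofMemStateSet {f : A → ℂ} (hf : f ∈ stateSet A) : CStarState A :=
  letI := CStarAlgebra.spectralOrder A
  haveI := CStarAlgebra.spectralOrderedRing A
  ⟨PositiveLinearMap.mk₀ (hf.1.mk' f) fun x hx => by
    obtain ⟨b, rfl⟩ := CStarAlgebra.nonneg_iff_eq_star_mul_self.1 hx
    exact hf.2.1 b, hf.2.2⟩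

/-- The canonical cyclic vector of the GNS space. -/
def vec (φ : CStarState A) : φ.Space :=
  letI := CStarAlgebra.spectralOrder A
  haveI := CStarAlgebra.spectralOrderedRing A
  ((φ.1.toPreGNS 1 : φ.1.PreGNS) : φ.1.GNS)

/-- The value of a state at an element, without reference to the spectral order. -/
def val (φ : CStarState A) (a : A) : ℂ :=
  letI := CStarAlgebra.spectralOrder A
  φ.1 a

theorem rep_vec (φ : CStarState A) (a : A) :
    letI := CStarAlgebra.spectralOrder A
    haveI := CStarAlgebra.spectralOrderedRing A
    φ.rep a φ.vec = ((φ.1.toPreGNS a : φ.1.PreGNS) : φ.1.GNS) := by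
  let _ := CStarAlgebra.spectralOrder A
  have := CStarAlgebra.spectralOrderedRing A
  refine (PositiveLinearMap.gnsNonUnitalStarAlgHom_apply_coe φ.1).trans ?_
  simp

theorem denseRange_rep_vec (φ : CStarState A) : DenseRange fun a => φ.rep a φ.vec := by
  let _ := CStarAlgebra.spectralOrder A
  have := CStarAlgebra.spectralOrderedRing A
  rw [show (fun a => φ.rep a φ.vec) = fun a => ((φ.1.toPreGNS a : φ.1.PreGNS) : φ.1.GNS) from
    funext fun a => φ.rep_vec a]
  exact UniformSpace.Completion.denseRange_coe.comp φ.1.toPreGNS.surjective.denseRange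
    (UniformSpace.Completion.continuous_coe _)

theorem inner_rep_vec (φ : CStarState A) (a b : A) :
    inner ℂ (φ.rep a φ.vec) (φ.rep b φ.vec) = φ.val (star a * b) := by
  let _ := CStarAlgebra.spectralOrder A
  have := CStarAlgebra.spectralOrderedRing A
  rw [rep_vec, rep_vec]
  exact UniformSpace.Completion.inner_coe _ _

theorem inner_vec_rep (φ : CStarState A) (a : A) : inner ℂ φ.vec (φ.rep a φ.vec) = φ.val a := by
  simpa using φ.inner_rep_vec 1 a

theorem norm_vec (φ : CStarState A) : ‖φ.vec‖ = 1 := by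
  have hsq : (‖φ.vec‖ : ℂ) ^ 2 = 1 := by
    have hone := φ.inner_vec_rep 1
    rw [map_one, one_apply_eq_self, inner_self_eq_norm_sq_to_K] at hone
    exact hone.trans φ.2
  rw [← pow_eq_one_iff_of_nonneg (norm_nonneg _) two_ne_zero]
  exact_mod_cast hsq

end CStarState

theorem norm_apply_le_of_mem_stateSet {f : A → ℂ} (hf : f ∈ stateSet A) (a : A) :
    ‖f a‖ ≤ ‖a‖ := by
  let φ := CStarState.ofMemStateSet hf
  calc ‖f a‖ = ‖inner ℂ φ.vec (φ.rep a φ.vec)‖ := congrArg norm (φ.inner_vec_rep a).symm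
    _ ≤ ‖φ.vec‖ * (‖φ.rep a‖ * ‖φ.vec‖) := (norm_inner_le_norm _ _).trans
      (mul_le_mul_of_nonneg_left (ContinuousLinearMap.le_opNorm _ _) (norm_nonneg _))
    _ = ‖φ.rep a‖ := by rw [φ.norm_vec, one_mul, mul_one]
    _ ≤ ‖a‖ := NonUnitalStarAlgHom.norm_apply_le _ a

theorem isClosed_stateSet : IsClosed (stateSet A) := by
  have hlin : {f : A → ℂ | IsLinearMap ℂ f} = range ((⇑) : (A →ₗ[ℂ] ℂ) → A → ℂ) :=
    Set.ext fun f => ⟨fun hf => ⟨hf.mk' f, rfl⟩, by rintro ⟨g, rfl⟩; exact g.isLinear⟩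
  have hpos : IsClosed {f : A → ℂ | ∀ a, 0 ≤ f (star a * a)} := by
    simp only [ofPred_forall]
    exact isClosed_iInter fun a => isClosed_le continuous_const (continuous_apply _)
  exact (hlin ▸ LinearMap.isClosed_range_coe A ℂ (RingHom.id ℂ)).inter
    (hpos.inter (isClosed_eq (continuous_apply _) continuous_const))

theorem isCompact_stateSet : IsCompact (stateSet A) :=
  (isCompact_univ_pi fun a : A => isCompact_closedBall (0 : ℂ) ‖a‖).of_isClosed_subset
    isClosed_stateSet fun _ hf a _ => mem_closedBall_zero_iff.2 (norm_apply_le_of_mem_stateSet hf a)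

theorem exists_complex_extension (f : A →ₗ[ℝ] ℝ) :
    ∃ g : A →ₗ[ℂ] ℂ, ∀ a, IsSelfAdjoint a → g a = f a := by
  let fRe : Module.Dual ℝ A := f ∘ₗ (selfAdjoint.submodule ℝ A).subtype ∘ₗ realPart
  refine ⟨fRe.extendRCLike (𝕜 := ℂ), fun a ha => ?_⟩
  have hre : fRe a = f a := congrArg f ha.coe_realPart
  have him : fRe ((RCLike.I : ℂ) • a) = 0 := by
    change f (realPart (Complex.I • a) : A) = 0
    rw [realPart_I_smul, ha.imaginaryPart, neg_zero, ZeroMemClass.coe_zero, map_zero]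
  rw [Module.Dual.extendRCLike_apply, him, hre]
  simp

section Order

attribute [local instance] CStarAlgebra.spectralOrder CStarAlgebra.spectralOrderedRing

theorem exists_real_functional_pos {b : A} (hb : 0 ≤ b) (hb0 : b ≠ 0) :
    ∃ f : A →L[ℝ] ℝ, (∀ a, 0 ≤ a → 0 ≤ f a) ∧ 0 < f b := by
  obtain ⟨f, hf, hfb⟩ := (ProperCone.positive ℝ A).hyperplane_separation_point (x₀ := -b)
    fun h => hb0 (le_antisymm (neg_nonneg.1 (show 0 ≤ -b from h)) hb)
  exact ⟨f, hf, by simpa using hfb⟩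

theorem exists_mem_stateSet_pos {x : A} (hx : x ≠ 0) :
    ∃ f ∈ stateSet A, 0 < (f (star x * x)).re := by
  set b := star x * x
  have hb : 0 ≤ b := star_mul_self_nonneg x
  obtain ⟨f, hf, hfb⟩ :=
    exists_real_functional_pos hb ((CStarRing.star_mul_self_eq_zero_iff x).not.2 hx)
  obtain ⟨g, hg⟩ := exists_complex_extension f.toLinearMap
  replace hg (a : A) (ha : 0 ≤ a) : g a = f a := hg a (.of_nonneg ha)
  have hf1 : 0 < f 1 := by
    have hle : f b ≤ ‖b‖ * f 1 := by
      simpa [Algebra.algebraMap_eq_smul_one] using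
        hf _ (sub_nonneg.2 (IsSelfAdjoint.le_algebraMap_norm_self (.of_nonneg hb)))
    exact pos_of_mul_pos_right (hfb.trans_le hle) (norm_nonneg b)
  refine ⟨(f 1 : ℂ)⁻¹ • g, ⟨((f 1 : ℂ)⁻¹ • g).isLinear, fun a => ?_, ?_⟩, ?_⟩
  · have ha := star_mul_self_nonneg a
    rw [Pi.smul_apply, hg _ ha, smul_eq_mul, ← Complex.ofReal_inv, ← Complex.ofReal_mul]
    exact Complex.zero_le_real.2 (mul_nonneg (inv_nonneg.2 hf1.le) (hf _ ha))
  · rw [Pi.smul_apply, hg 1 zero_le_one, smul_eq_mul]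
    exact inv_mul_cancel₀ (Complex.ofReal_ne_zero.2 hf1.ne')
  · rw [Pi.smul_apply, hg b hb, smul_eq_mul, ← Complex.ofReal_inv, ← Complex.ofReal_mul,
      Complex.ofReal_re]
    positivity

end Order

theorem exists_mem_extremePoints_stateSet_pos {x : A} (hx : x ≠ 0) :
    ∃ f ∈ (stateSet A).extremePoints ℝ, 0 < (f (star x * x)).re := by
  obtain ⟨g, hg, hgx⟩ := exists_mem_stateSet_pos hx
  let l : (A → ℂ) →L[ℝ] ℝ := Complex.reCLM.comp (ContinuousLinearMap.proj (star x * x))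
  -- By Krein–Milman, the compact face on which `l` is maximal has an extreme point.
  have hface : IsExposed ℝ (stateSet A) {f ∈ stateSet A | ∀ f' ∈ stateSet A, l f' ≤ l f} :=
    fun _ => ⟨l, rfl⟩
  obtain ⟨z, hz, hzmax⟩ := isCompact_stateSet.exists_isMaxOn ⟨g, hg⟩ l.continuous.continuousOn
  obtain ⟨f, hf⟩ := (hface.isCompact isCompact_stateSet).extremePoints_nonempty ⟨z, hz, hzmax⟩
  exact ⟨f, hface.isExtreme.extremePoints_subset_extremePoints hf, hgx.trans_le (hf.1.2 g hg)⟩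

section Representation

variable {H : Type*} [NormedAddCommGroup H] [InnerProductSpace ℂ H] [CompleteSpace H]
  (π : A →⋆ₐ[ℂ] (H →L[ℂ] H))

theorem inner_rep_apply_left (a : A) (x y : H) : inner ℂ (π a x) y = inner ℂ x (π (star a) y) := by
  rw [map_star, ContinuousLinearMap.star_eq_adjoint, ContinuousLinearMap.adjoint_inner_right]

variable {π} in
theorem rep_apply_mem_orthogonal {M : Submodule ℂ H} (hM : ∀ a, ∀ x ∈ M, π a x ∈ M) (a : A)
    {x : H} (hx : x ∈ Mᗮ) : π a x ∈ Mᗮ := by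
  rw [Submodule.mem_orthogonal] at hx ⊢
  intro y hy
  rw [← star_star a, ← inner_rep_apply_left]
  exact hx _ (hM _ _ hy)

theorem vectorState_mem_stateSet {ξ : H} (hξ : ‖ξ‖ = 1) :
    (fun a => inner ℂ ξ (π a ξ)) ∈ stateSet A := by
  refine ⟨⟨fun a b => by simp, fun c a => by simp⟩,
    fun a => ?_, by simp [inner_self_eq_norm_sq_to_K, hξ]⟩
  have hinner : inner ℂ ξ (π (star a * a) ξ) = inner ℂ (π a ξ) (π a ξ) := by
    rw [inner_rep_apply_left, map_mul, mul_apply_eq_comp]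
  beta_reduce
  rw [hinner, inner_self_eq_norm_sq_to_K]
  norm_cast
  exact Complex.zero_le_real.2 (sq_nonneg _)

theorem inner_rep_normalize (z : H) (a : A) :
    inner ℂ z (π a z) =
      (‖z‖ ^ 2 : ℝ) * inner ℂ ((‖z‖⁻¹ : ℂ) • z) (π a ((‖z‖⁻¹ : ℂ) • z)) := by
  rcases eq_or_ne z 0 with rfl | hz
  · simp
  have hz' : (‖z‖ : ℂ) ≠ 0 := by exact_mod_cast norm_ne_zero_iff.2 hz
  simp only [map_smul, inner_smul_left, inner_smul_right, map_inv₀, Complex.conj_ofReal,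
    Complex.ofReal_pow]
  field_simp

variable {π}

theorem inner_rep_eq_of_mem_extremePoints {ξ x y : H} (hξ : ‖ξ‖ = 1)
    (hext : (fun a => inner ℂ ξ (π a ξ)) ∈ (stateSet A).extremePoints ℝ)
    (hadd : ∀ a, inner ℂ ξ (π a ξ) = inner ℂ x (π a x) + inner ℂ y (π a y)) (a : A) :
    inner ℂ x (π a x) = (‖x‖ ^ 2 : ℝ) * inner ℂ ξ (π a ξ) := by
  have hsum : ‖x‖ ^ 2 + ‖y‖ ^ 2 = 1 := by
    have hone := hadd 1
    simp only [map_one, one_apply_eq_self, inner_self_eq_norm_sq_to_K, hξ] at hone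
    norm_cast at hone
    simpa using (Complex.ofReal_injective hone).symm
  rcases eq_or_ne x 0 with rfl | hx
  · simp
  rcases eq_or_ne y 0 with rfl | hy
  · have hnorm : ‖x‖ ^ 2 = 1 := by simpa using hsum
    simp [hnorm, hadd a]
  have hunit {z : H} (hz : z ≠ 0) : ‖(‖z‖⁻¹ : ℂ) • z‖ = 1 := by
    rw [norm_smul]
    simp [hz]
  have heq := (mem_extremePoints_iff_left.1 hext).2 _ (vectorState_mem_stateSet π (hunit hx)) _
    (vectorState_mem_stateSet π (hunit hy))
    ⟨‖x‖ ^ 2, ‖y‖ ^ 2, by positivity, by positivity, hsum, funext fun a => by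
      simp only [Pi.add_apply, Pi.smul_apply, Complex.real_smul]
      rw [← inner_rep_normalize, ← inner_rep_normalize, hadd]⟩
  rw [inner_rep_normalize]
  exact congrArg _ (congrFun heq a)

theorem eq_top_of_denseRange_of_mem {ξ : H} (hd : DenseRange fun a => π a ξ) {M : Submodule ℂ H}
    (hcl : IsClosed (M : Set H)) (hM : ∀ a, ∀ x ∈ M, π a x ∈ M) (hξ : ξ ∈ M) : M = ⊤ :=
  SetLike.coe_injective (eq_univ_of_forall fun y =>
    closure_minimal (range_subset_iff.2 fun a => hM a _ hξ) hcl (hd y))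

theorem isIrreducibleRep_of_mem_extremePoints {ξ : H} (hξ : ‖ξ‖ = 1)
    (hd : DenseRange fun a => π a ξ)
    (hext : (fun a => inner ℂ ξ (π a ξ)) ∈ (stateSet A).extremePoints ℝ) :
    IsIrreducibleRep π := by
  refine ⟨⟨ξ, 0, fun h => by simp [h] at hξ⟩, fun M hcl hM => ?_⟩
  have := hcl.completeSpace_coe
  obtain ⟨x, hx, y, hy, hxy⟩ := M.exists_add_mem_mem_orthogonal ξ
  have hxy0 (a) : inner ℂ x (π a y) = 0 :=
    Submodule.inner_right_of_mem_orthogonal hx (rep_apply_mem_orthogonal hM a hy)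
  have hyx0 (a) : inner ℂ y (π a x) = 0 :=
    Submodule.inner_left_of_mem_orthogonal (hM a x hx) hy
  have hpure := inner_rep_eq_of_mem_extremePoints (x := x) (y := y) hξ hext fun a => by
    rw [hxy, map_add, inner_add_left, inner_add_right, inner_add_right, hxy0, hyx0, add_zero,
      zero_add]
  -- Purity makes the component `x` of `ξ` in `M` a multiple of `ξ`.
  have hxξ : x = ((‖x‖ ^ 2 : ℝ) : ℂ) • ξ := by
    rw [← sub_eq_zero, ← inner_self_eq_zero (𝕜 := ℂ)]
    refine hd.induction_on (p := fun z => inner ℂ (x - ((‖x‖ ^ 2 : ℝ) : ℂ) • ξ) z = 0) _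
      (isClosed_eq (by fun_prop) continuous_const) fun a => ?_
    have hxa : inner ℂ x (π a ξ) = inner ℂ x (π a x) := by
      rw [hxy, map_add, inner_add_right, hxy0, add_zero]
    rw [inner_sub_left, inner_smul_left, Complex.conj_ofReal, hxa, hpure, sub_self]
  rcases eq_or_ne x 0 with hx0 | hx0
  · left
    rw [← Submodule.orthogonal_eq_top_iff]
    rw [hx0, zero_add] at hxy
    exact eq_top_of_denseRange_of_mem hd M.isClosed_orthogonal
      (fun a z hz => rep_apply_mem_orthogonal hM a hz) (hxy ▸ hy)
  · have hc : ((‖x‖ ^ 2 : ℝ) : ℂ) ≠ 0 := by exact_mod_cast (pow_pos (norm_pos_iff.2 hx0) 2).ne'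
    exact Or.inr (eq_top_of_denseRange_of_mem hd hcl hM
      ((M.smul_mem_iff hc).1 (hxξ ▸ hx)))

end Representation

theorem exists_isIrreducibleRep_apply_ne_zero {x : A} (hx : x ≠ 0) :
    ∃ φ : CStarState A, IsIrreducibleRep φ.rep ∧ φ.rep x ≠ 0 := by
  obtain ⟨f, hf, hfx⟩ := exists_mem_extremePoints_stateSet_pos hx
  let φ := CStarState.ofMemStateSet hf.1
  have hφ : (fun b => inner ℂ φ.vec (φ.rep b φ.vec)) = f := funext φ.inner_vec_rep
  refine ⟨φ, isIrreducibleRep_of_mem_extremePoints φ.norm_vec φ.denseRange_rep_vec (hφ ▸ hf),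
    fun h0 => ?_⟩
  rw [← hφ] at hfx
  simp [map_mul, h0] at hfx

end States

/-! ### Finite-dimensional irreducible representations -/

section RingHom

variable {A B D : Type*} [Ring A] [Ring B] [IsSimpleRing B] [Ring D] [Nontrivial D]

theorem exists_injective_apply_eq_of_ker_le {ρ : A →+* B} (hρ : Function.Surjective ρ)
    {σ : A →+* D} (h : RingHom.ker ρ ≤ RingHom.ker σ) :
    ∃ θ : B →+* D, Function.Injective θ ∧ ∀ a, θ (ρ a) = σ a :=
  ⟨ρ.liftOfSurjective hρ ⟨σ, h⟩, RingHom.injective _, ρ.liftOfSurjective_comp_apply hρ ⟨σ, h⟩⟩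

theorem exists_injective_algHom_apply_eq_of_ker_le {R : Type*} [CommRing R] [Algebra R A]
    [Algebra R B] [Algebra R D] {ρ : A →ₐ[R] B} (hρ : Function.Surjective ρ) {σ : A →ₐ[R] D}
    (h : RingHom.ker ρ ≤ RingHom.ker σ) :
    ∃ θ : B →ₐ[R] D, Function.Injective θ ∧ ∀ a, θ (ρ a) = σ a := by
  obtain ⟨θ, hθ, hcomp⟩ := exists_injective_apply_eq_of_ker_le (ρ := (ρ : A →+* B)) hρ
    (σ := (σ : A →+* D)) h
  exact ⟨{ θ with commutes' r := by simpa using hcomp (algebraMap R A r) }, hθ, hcomp⟩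

theorem ker_eq_of_ker_le_of_surjective {F G : Type*} [FunLike F A B] [RingHomClass F A B]
    [FunLike G A D] [RingHomClass G A D] {ρ : F} (hρ : Function.Surjective ρ) {σ : G}
    (h : RingHom.ker ρ ≤ RingHom.ker σ) : RingHom.ker ρ = RingHom.ker σ := by
  obtain ⟨θ, hθ, hcomp⟩ := exists_injective_apply_eq_of_ker_le (ρ := (ρ : A →+* B)) hρ
    (σ := (σ : A →+* D)) h
  exact le_antisymm h fun a ha => (map_eq_zero_iff θ hθ).1 ((hcomp a).trans ha)

end RingHom

theorem surjective_of_forall_eq_zero_imp {𝕜 V W F G : Type*} [Field 𝕜] [AddCommGroup V]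
    [Module 𝕜 V] [AddCommGroup W] [Module 𝕜 W] [FiniteDimensional 𝕜 W] [FunLike F V W]
    [LinearMapClass F 𝕜 V W] [FunLike G V W] [LinearMapClass G 𝕜 V W] {ρ : F} {σ : G}
    (hσ : Function.Surjective σ) (h : ∀ v, ρ v = 0 → σ v = 0) : Function.Surjective ρ := by
  obtain ⟨s, hs⟩ := (σ : V →ₗ[𝕜] W).exists_rightInverse_of_surjective (LinearMap.range_eq_top.2 hσ)
  have hinj : Function.Injective ((ρ : V →ₗ[𝕜] W) ∘ₗ s) := by
    rw [injective_iff_map_eq_zero]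
    exact fun w hw => (LinearMap.congr_fun hs w).symm.trans (h _ hw)
  exact .of_comp (g := s) (LinearMap.injective_iff_surjective.1 hinj)

theorem continuous_starAlgHom {A D : Type*} [CStarAlgebra A] [CStarAlgebra D] (σ : A →⋆ₐ[ℂ] D) :
    Continuous σ :=
  AddMonoidHomClass.continuous_of_bound σ 1 fun a => by
    simpa using NonUnitalStarAlgHom.norm_apply_le σ a

section Conj

variable {A H K : Type*} [CStarAlgebra A] [NormedAddCommGroup H] [InnerProductSpace ℂ H]
  [CompleteSpace H] [NormedAddCommGroup K] [InnerProductSpace ℂ K] [CompleteSpace K]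

/-- The representation on `K` that is unitarily equivalent to `π` through `e : H ≃ₗᵢ[ℂ] K`. -/
def conjRep (e : H ≃ₗᵢ[ℂ] K) (π : A →⋆ₐ[ℂ] (H →L[ℂ] H)) : A →⋆ₐ[ℂ] (K →L[ℂ] K) :=
  (e.conjStarAlgEquiv : (H →L[ℂ] H) →⋆ₐ[ℂ] (K →L[ℂ] K)).comp π

theorem conjRep_apply (e : H ≃ₗᵢ[ℂ] K) (π : A →⋆ₐ[ℂ] (H →L[ℂ] H)) (a : A) (x : K) :
    conjRep e π a x = e (π a (e.symm x)) :=
  rfl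

end Conj

section FiniteDimensional

variable {E : Type*} [NormedAddCommGroup E] [InnerProductSpace ℂ E]

theorem isSimpleRing_continuousEnd [FiniteDimensional ℂ E] [Nontrivial E] :
    IsSimpleRing (E →L[ℂ] E) := by
  have : Nonempty (Fin (Module.finrank ℂ E)) := ⟨⟨0, Module.finrank_pos⟩⟩
  exact .of_ringEquiv ((LinearMap.toMatrixAlgEquiv (Module.finBasis ℂ E)).symm.trans
    (Module.End.toContinuousLinearMap E)).toRingEquiv inferInstance

variable [CompleteSpace E] {A : Type*} [CStarAlgebra A]

theorem IsIrreducibleRep.surjective [FiniteDimensional ℂ E] {π : A →⋆ₐ[ℂ] (E →L[ℂ] E)}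
    (hπ : IsIrreducibleRep π) : Function.Surjective π := by
  let _ : Module A E := Module.compHom E (π : A →+* (E →L[ℂ] E))
  have hsmul (a : A) (x : E) : a • x = π a x := rfl
  have := hπ.nontrivial
  have : IsScalarTower ℂ A E := ⟨fun c a x => by simp [hsmul]⟩
  have : IsSimpleModule A E := (isSimpleModule_iff _ _).2
    { exists_pair_ne := ⟨⊥, ⊤, bot_ne_top⟩
      eq_bot_or_eq_top M := by
        simpa using hπ.eq_bot_or_eq_top (M.restrictScalars ℂ)
          (Submodule.closed_of_finiteDimensional _) fun a x hx => M.smul_mem a hx }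
  intro T
  -- By Schur's lemma `T` commutes with all `A`-linear maps, so the density theorem applies to it.
  let f : Module.End (Module.End A E) E :=
    { toFun := T
      map_add' := map_add T
      map_smul' D x := by
        obtain ⟨μ, rfl⟩ := (IsSimpleModule.algebraMap_end_bijective_of_isAlgClosed ℂ).2 D
        simp }
  classical
  let b := Module.finBasis ℂ E
  obtain ⟨a, ha⟩ := jacobson_density f (Finset.univ.image b)
  exact ⟨a, ContinuousLinearMap.coe_injective (b.ext fun i => (ha (b i) (by simp)).symm)⟩

theorem IsIrreducibleRep.of_surjective [Nontrivial E] {π : A →⋆ₐ[ℂ] (E →L[ℂ] E)}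
    (hπ : Function.Surjective π) : IsIrreducibleRep π := by
  refine ⟨inferInstance, fun M _ hM => or_iff_not_imp_left.2 fun hbot => ?_⟩
  obtain ⟨x, hx, hx0⟩ := M.ne_bot_iff.1 hbot
  refine Submodule.eq_top_iff'.2 fun y => ?_
  obtain ⟨a, ha⟩ := hπ (InnerProductSpace.rankOne ℂ y ((inner ℂ x x)⁻¹ • x))
  have hax := hM a x hx
  rw [ha, InnerProductSpace.rankOne_apply, inner_smul_left, map_inv₀, inner_self_conj,
    inv_mul_cancel₀ (by simpa using hx0), one_smul] at hax
  exact hax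

theorem IsIrreducibleRep.exists_surjective_of_finrank_eq [FiniteDimensional ℂ E] {H : Type*}
    [NormedAddCommGroup H] [InnerProductSpace ℂ H] [CompleteSpace H] [FiniteDimensional ℂ H]
    (h : Module.finrank ℂ H = Module.finrank ℂ E) {π : A →⋆ₐ[ℂ] (H →L[ℂ] H)}
    (hπ : IsIrreducibleRep π) :
    ∃ ρ : A →⋆ₐ[ℂ] (E →L[ℂ] E), Function.Surjective ρ ∧ RingHom.ker ρ = RingHom.ker π := by
  let e : H ≃ₗᵢ[ℂ] E := (stdOrthonormalBasis ℂ H).equiv (stdOrthonormalBasis ℂ E) (finCongr h)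
  refine ⟨conjRep e π, e.conjStarAlgEquiv.surjective.comp hπ.surjective, Ideal.ext fun a => ?_⟩
  exact map_eq_zero_iff e.conjStarAlgEquiv e.conjStarAlgEquiv.injective

end FiniteDimensional

/-! ### The space of representations on a fixed Hilbert space -/

section Threshold

open scoped CStarAlgebra

variable {A : Type*} [CStarAlgebra A] {b : A} (hb : IsSelfAdjoint b) {δ : ℝ}
include hb

theorem cfc_max_abs_sub_eq_zero_iff (hδ : 0 ≤ δ) :
    cfc (fun r : ℝ => max (|r| - δ) 0) b = 0 ↔ ‖b‖ ≤ δ := by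
  conv_rhs => rw [← cfc_id' ℝ b, norm_cfc_le_iff (fun r : ℝ => r) b hδ]
  rw [← cfc_zero ℝ b, cfc_eq_cfc_iff_eqOn]
  simp [Set.EqOn]

theorem map_cfc_max_abs_sub_eq_zero_iff {D : Type*} [CStarAlgebra D] (σ : A →⋆ₐ[ℂ] D)
    (hδ : 0 ≤ δ) : σ (cfc (fun r : ℝ => max (|r| - δ) 0) b) = 0 ↔ ‖σ b‖ ≤ δ := by
  rw [StarAlgHom.map_cfc σ _ b (by fun_prop) (map_continuous σ) hb (hb.map σ),
    cfc_max_abs_sub_eq_zero_iff (hb.map σ) hδ]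

end Threshold

/-- The space of representations of `A` on `E` with the topology of pointwise norm convergence. -/
def RepSpace (A E : Type*) [CStarAlgebra A] [NormedAddCommGroup E] [InnerProductSpace ℂ E]
    [CompleteSpace E] : Type _ :=
  A →⋆ₐ[ℂ] (E →L[ℂ] E)

namespace RepSpace

open scoped CStarAlgebra

variable {A E : Type*} [CStarAlgebra A] [NormedAddCommGroup E] [InnerProductSpace ℂ E]
  [CompleteSpace E]

instance : FunLike (RepSpace A E) A (E →L[ℂ] E) :=
  inferInstanceAs (FunLike (A →⋆ₐ[ℂ] (E →L[ℂ] E)) A (E →L[ℂ] E))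

instance : AlgHomClass (RepSpace A E) ℂ A (E →L[ℂ] E) :=
  inferInstanceAs (AlgHomClass (A →⋆ₐ[ℂ] (E →L[ℂ] E)) ℂ A (E →L[ℂ] E))

instance : StarHomClass (RepSpace A E) A (E →L[ℂ] E) :=
  inferInstanceAs (StarHomClass (A →⋆ₐ[ℂ] (E →L[ℂ] E)) A (E →L[ℂ] E))

instance : TopologicalSpace (RepSpace A E) := .induced (⇑) inferInstance

theorem continuous_apply (a : A) : Continuous fun ρ : RepSpace A E => ρ a :=
  continuous_pi_iff.1 continuous_induced_dom a

theorem continuous_iff {X : Type*} [TopologicalSpace X] {f : X → RepSpace A E} :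
    Continuous f ↔ ∀ a, Continuous fun x => f x a :=
  continuous_induced_rng.trans continuous_pi_iff

theorem isEmbedding_coe : Topology.IsEmbedding ((⇑) : RepSpace A E → A → E →L[ℂ] E) :=
  ⟨⟨rfl⟩, DFunLike.coe_injective⟩

instance : T2Space (RepSpace A E) := isEmbedding_coe.t2Space

theorem isClosed_range_coe : IsClosed (Set.range ((⇑) : RepSpace A E → A → E →L[ℂ] E)) := by
  have hrange : Set.range ((⇑) : RepSpace A E → A → E →L[ℂ] E) =
      Set.range ((⇑) : (A →ₗ[ℂ] (E →L[ℂ] E)) → A → E →L[ℂ] E) ∩ {f | f 1 = 1} ∩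
        {f | ∀ a b, f (a * b) = f a * f b} ∩ ⋂ a, {f | f (star a) = star (f a)} := by
    ext f
    simp only [Set.mem_inter_iff, Set.mem_iInter, Set.mem_ofPred_eq]
    constructor
    · rintro ⟨ρ, rfl⟩
      exact ⟨⟨⟨⟨(ρ : A →ₗ[ℂ] (E →L[ℂ] E)), rfl⟩, map_one ρ⟩, map_mul ρ⟩, map_star ρ⟩
    · rintro ⟨⟨⟨⟨g, rfl⟩, hone⟩, hmul⟩, hstar⟩
      exact ⟨show A →⋆ₐ[ℂ] (E →L[ℂ] E) from { AlgHom.ofLinearMap g hone hmul with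
        map_star' := hstar }, rfl⟩
  rw [hrange]
  exact (((LinearMap.isClosed_range_coe A (E →L[ℂ] E) (RingHom.id ℂ)).inter
    (isClosed_setOfPred_map_one A (E →L[ℂ] E))).inter
    (isClosed_setOfPred_map_mul A (E →L[ℂ] E))).inter
    (isClosed_iInter fun a => isClosed_eq (by fun_prop) (by fun_prop))

instance [FiniteDimensional ℂ E] : CompactSpace (RepSpace A E) := by
  have : ProperSpace (E →L[ℂ] E) := FiniteDimensional.proper ℂ _
  rw [← isCompact_univ_iff, isEmbedding_coe.isCompact_iff, Set.image_univ]
  refine (isCompact_univ_pi fun a : A =>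
    isCompact_closedBall (0 : E →L[ℂ] E) ‖a‖).of_isClosed_subset isClosed_range_coe ?_
  rintro _ ⟨ρ, rfl⟩ a -
  exact mem_closedBall_zero_iff.2 (NonUnitalStarAlgHom.norm_apply_le ρ a)

instance [TopologicalSpace.SeparableSpace A] [FiniteDimensional ℂ E] :
    SecondCountableTopology (RepSpace A E) := by
  have : ProperSpace (E →L[ℂ] E) := FiniteDimensional.proper ℂ _
  have hcont : Continuous fun (ρ : RepSpace A E) (n : ℕ) => ρ (TopologicalSpace.denseSeq A n) :=
    continuous_pi fun n => continuous_apply _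
  have hinj : Function.Injective
      fun (ρ : RepSpace A E) (n : ℕ) => ρ (TopologicalSpace.denseSeq A n) :=
    fun ρ σ h => DFunLike.ext' <| (TopologicalSpace.denseRange_denseSeq A).equalizer
      (map_continuous ρ) (map_continuous σ) h
  exact (hcont.isClosedEmbedding hinj).isEmbedding.secondCountableTopology

theorem exists_ker_le_of_isCompact [FiniteDimensional ℂ E] {D : Type*} [CStarAlgebra D]
    [Nontrivial D] {σ : A →⋆ₐ[ℂ] D}
    (hσ : ∀ a b, a ∉ RingHom.ker σ → b ∉ RingHom.ker σ → ∃ c, a * c * b ∉ RingHom.ker σ)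
    {T : Set (RepSpace A E)} (hT : IsCompact T)
    (h : ∀ a, (∀ ρ ∈ T, ρ a = 0) → σ a = 0) : ∃ ρ ∈ T, RingHom.ker ρ ≤ RingHom.ker σ := by
  by_contra! hcon
  obtain ⟨y, hy, hyT⟩ : ∃ y, y ∉ RingHom.ker σ ∧ ∀ ρ ∈ T, ρ y = 0 := by
    refine hT.induction_on (p := fun T => ∃ y, y ∉ RingHom.ker σ ∧ ∀ ρ ∈ T, ρ y = 0)
      ⟨1, by simp [RingHom.mem_ker], by simp⟩ ?_ ?_ fun ρ hρ => ?_
    · rintro s t hst ⟨y, hy, hyt⟩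
      exact ⟨y, hy, fun ρ hρ => hyt ρ (hst hρ)⟩
    · rintro s t ⟨y, hy, hys⟩ ⟨z, hz, hzt⟩
      obtain ⟨c, hc⟩ := hσ y z hy hz
      refine ⟨y * c * z, hc, ?_⟩
      rintro ρ (hρ | hρ)
      · simp [map_mul, hys ρ hρ]
      · simp [map_mul, hzt ρ hρ]
    · obtain ⟨a, ha, hσa⟩ := SetLike.not_le_iff_exists.1 (hcon ρ hρ)
      -- A spectral cutdown of `a⋆a` vanishes near `ρ`, where `a⋆a` is small, but not under `σ`.
      have hb : IsSelfAdjoint (star a * a) := .star_mul_self a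
      have hδ : 0 < ‖σ (star a * a)‖ := by
        rw [map_mul, map_star, CStarRing.norm_star_mul_self]
        exact mul_self_pos.2 (norm_ne_zero_iff.2 hσa)
      refine ⟨{ρ | ‖ρ (star a * a)‖ < ‖σ (star a * a)‖ / 2}, mem_nhdsWithin_of_mem_nhds
        ((isOpen_lt (continuous_apply _).norm continuous_const).mem_nhds ?_),
        cfc (fun r : ℝ => max (|r| - ‖σ (star a * a)‖ / 2) 0) (star a * a), ?_, fun ρ hρ => ?_⟩
      · simpa [map_mul, show ρ a = 0 from ha] using hδ
      · rw [RingHom.mem_ker, map_cfc_max_abs_sub_eq_zero_iff hb σ (half_pos hδ).le]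
        linarith
      · exact (map_cfc_max_abs_sub_eq_zero_iff hb (show A →⋆ₐ[ℂ] (E →L[ℂ] E) from ρ)
          (half_pos hδ).le).2 hρ.le
  exact hy (h y hyT)

end RepSpace

section ProperImage

variable {X Y : Type*} [TopologicalSpace X] [TopologicalSpace Y] {f : X → Y}

theorem t2Space_of_isProperMap_of_surjective [T2Space X] (hf : IsProperMap f)
    (hs : Function.Surjective f) : T2Space Y := by
  refine ⟨fun x y hxy => ?_⟩
  obtain ⟨U, V, hU, hV, hxU, hyV, hUV⟩ := SeparatedNhds.of_isCompact_isCompact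
    (hf.isCompact_preimage isCompact_singleton) (hf.isCompact_preimage isCompact_singleton)
    (Disjoint.preimage f (Set.disjoint_singleton.2 hxy))
  have hopen {u : Set X} (hu : IsOpen u) : IsOpen (Set.kernImage f u) :=
    isClosedMap_iff_kernImage.1 hf.isClosedMap hu
  refine ⟨Set.kernImage f U, Set.kernImage f V, hopen hU, hopen hV, fun _ hz => hxU hz,
    fun _ hz => hyV hz, Set.disjoint_left.2 fun z hzU hzV => ?_⟩
  obtain ⟨w, rfl⟩ := hs z
  exact Set.disjoint_left.1 hUV (hzU rfl) (hzV rfl)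

theorem weaklyLocallyCompactSpace_of_isProperMap_of_surjective [WeaklyLocallyCompactSpace X]
    (hf : IsProperMap f) (hs : Function.Surjective f) : WeaklyLocallyCompactSpace Y := by
  refine ⟨fun y => ?_⟩
  obtain ⟨K, hK, hyK⟩ := exists_compact_superset
    (hf.isCompact_preimage (isCompact_singleton (x := y)))
  have hnhds : Set.kernImage f (interior K) ∈ nhds y :=
    (isClosedMap_iff_kernImage.1 hf.isClosedMap isOpen_interior).mem_nhds fun _ hz => hyK hz
  refine ⟨f '' K, hK.image hf.continuous, Filter.mem_of_superset hnhds fun z hz => ?_⟩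
  obtain ⟨w, rfl⟩ := hs z
  exact ⟨w, interior_subset (hz rfl), rfl⟩

end ProperImage

/-! ### The space of primitive ideals of a given dimension -/

section PrimOfDim

open Set

variable {A : Type u} [CStarAlgebra A]

theorem isOpen_setOf_notMem_primOfDim (d : ℕ) (a : A) : IsOpen {P : primOfDim A d | a ∉ P.1.1} := by
  have hopen : IsOpen {P : PrimitiveSpectrum A | a ∉ P.1} := ⟨{a}, by simp⟩
  exact hopen.preimage continuous_subtype_val

theorem continuous_primOfDim_iff {X : Type*} [TopologicalSpace X] {d : ℕ} {f : X → primOfDim A d} :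
    Continuous f ↔ ∀ a, IsOpen {x | a ∉ (f x).1.1} := by
  refine ⟨fun h a => (isOpen_setOf_notMem_primOfDim d a).preimage h, fun h => ?_⟩
  rw [continuous_induced_rng]
  refine ⟨?_⟩
  rintro _ ⟨F, rfl⟩
  have hpre : (Subtype.val ∘ f) ⁻¹' {P | ∃ a ∈ F, a ∉ P.1} = ⋃ a ∈ F, {x | a ∉ (f x).1.1} := by
    ext x; simp
  rw [hpre]
  exact isOpen_biUnion fun a _ => h a

variable {E : Type u} [NormedAddCommGroup E] [InnerProductSpace ℂ E] [CompleteSpace E]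

variable (A E) in
/-- The irreducible representations of `A` on the finite-dimensional space `E`, encoded as the
surjective ones (see `IsIrreducibleRep.surjective`). -/
def irrSpace : Set (RepSpace A E) := {ρ | Function.Surjective ρ}

namespace irrSpace

variable [FiniteDimensional ℂ E]

theorem mem_of_ker_le {ρ σ : RepSpace A E} (hσ : σ ∈ irrSpace A E)
    (h : RingHom.ker ρ ≤ RingHom.ker σ) : ρ ∈ irrSpace A E :=
  surjective_of_forall_eq_zero_imp (𝕜 := ℂ) hσ h

theorem isOpen : IsOpen (irrSpace A E) := by
  refine isOpen_iff_mem_nhds.2 fun ρ hρ => ?_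
  let b := Module.finBasis ℂ (E →L[ℂ] E)
  choose a ha using fun i => hρ (b i)
  have hopen : IsOpen {σ : RepSpace A E | LinearIndependent ℂ fun i => σ (a i)} :=
    isOpen_setOfPred_linearIndependent.preimage
      (continuous_pi fun i => RepSpace.continuous_apply (a i))
  refine Filter.mem_of_superset (hopen.mem_nhds ?_) fun σ hσ => ?_
  · simpa only [mem_ofPred_eq, ha] using b.linearIndependent
  · have hspan := LinearIndependent.span_eq_top_of_card_eq_finrank' hσ (by simp)
    refine (LinearMap.range_eq_top (f := (σ : A →ₗ[ℂ] (E →L[ℂ] E)))).1 (top_le_iff.1 ?_)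
    rw [← hspan, Submodule.span_le]
    rintro _ ⟨i, rfl⟩
    exact ⟨a i, rfl⟩

variable [Nontrivial E]

theorem ker_eq_of_ker_le {ρ σ : RepSpace A E} (hρ : ρ ∈ irrSpace A E)
    (h : RingHom.ker ρ ≤ RingHom.ker σ) : RingHom.ker ρ = RingHom.ker σ :=
  have := isSimpleRing_continuousEnd (E := E)
  ker_eq_of_ker_le_of_surjective hρ h

variable {d : ℕ} (hE : Module.finrank ℂ E = d)

/-- The kernel of an irreducible representation, as a point of `Prim_d A`. -/
def toPrim (ρ : irrSpace A E) : primOfDim A d :=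
  have hρ : IsIrreducibleRep (ρ.1 : A →⋆ₐ[ℂ] (E →L[ℂ] E)) := .of_surjective ρ.2
  ⟨⟨RingHom.ker ρ.1, E, _, _, _, _, hρ, rfl⟩, E, _, _, _, _, hρ, inferInstance, hE, rfl⟩

theorem toPrim_eq_iff {ρ σ : irrSpace A E} :
    toPrim hE ρ = toPrim hE σ ↔ RingHom.ker ρ.1 = RingHom.ker σ.1 :=
  Subtype.ext_iff.trans Subtype.ext_iff

theorem surjective_toPrim : Function.Surjective (toPrim (A := A) hE) := by
  rintro ⟨P, H, _, _, _, π, hπ, hfin, hd, hP⟩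
  obtain ⟨ρ, hρ, hker⟩ := hπ.exists_surjective_of_finrank_eq (hd.trans hE.symm)
  exact ⟨⟨ρ, hρ⟩, Subtype.ext (Subtype.ext (hker.trans hP))⟩

theorem continuous_toPrim : Continuous (toPrim (A := A) hE) :=
  continuous_primOfDim_iff.2 fun a =>
    isOpen_ne_fun ((RepSpace.continuous_apply a).comp continuous_subtype_val) continuous_const

theorem isClosedMap_toPrim : IsClosedMap (toPrim (A := A) hE) := by
  intro Z hZ
  refine isClosed_of_closure_subset fun P hP => ?_
  obtain ⟨σ, rfl⟩ := surjective_toPrim hE P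
  have hcl (a : A) (ha : ∀ ρ ∈ closure (Subtype.val '' Z), ρ a = 0) : σ.1 a = 0 := by
    by_contra hσ
    obtain ⟨_, hnot, ρ, hρ, rfl⟩ :=
      mem_closure_iff.1 hP _ (isOpen_setOf_notMem_primOfDim d a) hσ
    exact hnot (ha ρ.1 (subset_closure ⟨ρ, hρ, rfl⟩))
  obtain ⟨ρ, hρ, hker⟩ := RepSpace.exists_ker_le_of_isCompact
    (σ := show A →⋆ₐ[ℂ] (E →L[ℂ] E) from σ.1)
    (fun a b ha hb => (toPrim hE σ).1.2.exists_mul_mul_notMem ha hb)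
    isClosed_closure.isCompact hcl
  refine ⟨⟨ρ, mem_of_ker_le σ.2 hker⟩, ?_,
    (toPrim_eq_iff hE).2 (ker_eq_of_ker_le (mem_of_ker_le σ.2 hker) hker)⟩
  rwa [← hZ.closure_eq, closure_subtype]

theorem isProperMap_toPrim : IsProperMap (toPrim (A := A) hE) := by
  refine isProperMap_iff_isClosedMap_and_compact_fibers.2 ⟨continuous_toPrim hE,
    isClosedMap_toPrim hE, fun P => ?_⟩
  obtain ⟨σ, rfl⟩ := surjective_toPrim hE P
  have hfiber : Subtype.val '' (toPrim hE ⁻¹' {toPrim hE σ}) =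
      ⋂ a ∈ RingHom.ker σ.1, {ρ : RepSpace A E | ρ a = 0} := by
    ext ρ
    simp only [mem_image, mem_preimage, mem_singleton_iff, mem_iInter, mem_ofPred_eq, toPrim_eq_iff]
    constructor
    · rintro ⟨ρ, h, rfl⟩ a ha
      exact (h ▸ ha : a ∈ RingHom.ker ρ.1)
    · intro h
      have hker : RingHom.ker σ.1 = RingHom.ker ρ := ker_eq_of_ker_le σ.2 h
      exact ⟨⟨ρ, mem_of_ker_le σ.2 hker.ge⟩, hker.symm, rfl⟩
  rw [Topology.IsEmbedding.subtypeVal.isCompact_iff, hfiber]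
  exact (isClosed_iInter fun a => isClosed_iInter fun _ =>
    isClosed_eq (RepSpace.continuous_apply a) continuous_const).isCompact

end irrSpace

variable {d : ℕ}

theorem pos_of_mem_primOfDim {P : PrimitiveSpectrum A} (hP : P ∈ primOfDim A d) : 0 < d := by
  obtain ⟨H, _, _, _, π, hπ, _, rfl, -⟩ := hP
  have := hπ.nontrivial
  exact Module.finrank_pos

/-- The standard `d`-dimensional Hilbert space in the universe `u`. -/
abbrev StdHilbert (d : ℕ) : Type u := EuclideanSpace ℂ (ULift.{u} (Fin d))

theorem finrank_stdHilbert (d : ℕ) : Module.finrank ℂ (StdHilbert.{u} d) = d := by simp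

theorem nontrivial_stdHilbert {P : PrimitiveSpectrum A} (hP : P ∈ primOfDim A d) :
    Nontrivial (StdHilbert.{u} d) :=
  Module.nontrivial_of_finrank_pos (R := ℂ) ((finrank_stdHilbert d).symm ▸ pos_of_mem_primOfDim hP)

instance : T2Space (primOfDim A d) := by
  rcases isEmpty_or_nonempty (primOfDim A d) with _ | ⟨⟨P⟩⟩
  · infer_instance
  have := nontrivial_stdHilbert P.2
  exact t2Space_of_isProperMap_of_surjective (irrSpace.isProperMap_toPrim (finrank_stdHilbert d))
    (irrSpace.surjective_toPrim _)

instance : WeaklyLocallyCompactSpace (primOfDim A d) := by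
  rcases isEmpty_or_nonempty (primOfDim A d) with _ | ⟨⟨P⟩⟩
  · exact ⟨isEmptyElim⟩
  have := nontrivial_stdHilbert P.2
  have := (irrSpace.isOpen (A := A) (E := StdHilbert.{u} d)).locallyCompactSpace
  exact weaklyLocallyCompactSpace_of_isProperMap_of_surjective
    (irrSpace.isProperMap_toPrim (finrank_stdHilbert d)) (irrSpace.surjective_toPrim _)

instance [TopologicalSpace.SeparableSpace A] : SigmaCompactSpace (primOfDim A d) := by
  rcases isEmpty_or_nonempty (primOfDim A d) with _ | ⟨⟨P⟩⟩
  · infer_instance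
  have := nontrivial_stdHilbert P.2
  have := (irrSpace.isOpen (A := A) (E := StdHilbert.{u} d)).locallyCompactSpace
  rw [← isSigmaCompact_univ_iff, ← (irrSpace.surjective_toPrim (finrank_stdHilbert d)).range_eq]
  exact isSigmaCompact_range (irrSpace.continuous_toPrim _)

end PrimOfDim

/-! ### Factor representations -/

section Factor

variable {A : Type u} [CStarAlgebra A] {H : Type*} [NormedAddCommGroup H] [InnerProductSpace ℂ H]
  [CompleteSpace H] {π : A →⋆ₐ[ℂ] (H →L[ℂ] H)}

theorem exists_finiteDimensional_invariant_of_ker_le [Nontrivial H] {D : Type*} [Ring D]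
    [Algebra ℂ D] [FiniteDimensional ℂ D] {ρ : A →ₐ[ℂ] D} (h : RingHom.ker ρ ≤ RingHom.ker π) :
    ∃ K : Submodule ℂ H, FiniteDimensional ℂ K ∧ K ≠ ⊥ ∧ ∀ a, ∀ x ∈ K, π a x ∈ K := by
  obtain ⟨ξ, hξ⟩ := exists_ne (0 : H)
  let orbitMap : A →ₗ[ℂ] H := (ContinuousLinearMap.apply ℂ H ξ).toLinearMap ∘ₗ (π : A →ₗ[ℂ] _)
  have hker : LinearMap.ker (ρ : A →ₗ[ℂ] D) ≤ LinearMap.ker orbitMap := fun a ha => by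
    have hπa : π a = 0 := h ha
    simp [orbitMap, hπa]
  refine ⟨LinearMap.range orbitMap, ?_, ?_, ?_⟩
  · have : FiniteDimensional ℂ (A ⧸ LinearMap.ker (ρ : A →ₗ[ℂ] D)) :=
      (LinearMap.quotKerEquivRange _).symm.finiteDimensional
    rw [← Submodule.range_liftQ _ orbitMap hker]
    infer_instance
  · exact (Submodule.ne_bot_iff _).2 ⟨ξ, ⟨1, by simp [orbitMap]⟩, hξ⟩
  · rintro a _ ⟨b, rfl⟩
    exact ⟨a * b, by simp [orbitMap]⟩

/-- The restriction of a representation to a complete invariant subspace. -/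
def restrictInvariant (π : A →⋆ₐ[ℂ] (H →L[ℂ] H)) (K : Submodule ℂ H) [CompleteSpace K]
    (hK : ∀ a, ∀ x ∈ K, π a x ∈ K) : A →⋆ₐ[ℂ] (K →L[ℂ] K) where
  toFun a := ((π a).comp K.subtypeL).codRestrict K fun x => hK a x x.2
  map_one' := by ext; simp
  map_mul' a b := by ext; simp; rfl
  map_zero' := by ext; simp
  map_add' a b := by ext; simp; rfl
  commutes' r := by ext; simp [Algebra.algebraMap_eq_smul_one]
  map_star' a := by
    rw [ContinuousLinearMap.star_eq_adjoint, ContinuousLinearMap.eq_adjoint_iff]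
    intro x y
    exact (inner_rep_apply_left π (star a) (x : H) (y : H)).trans (by rw [star_star]; rfl)

theorem coe_restrictInvariant_apply (K : Submodule ℂ H) [CompleteSpace K]
    (hK : ∀ a, ∀ x ∈ K, π a x ∈ K) (a : A) (x : K) : (restrictInvariant π K hK a x : H) = π a x :=
  rfl

theorem exists_isIrreducibleRep_restrictInvariant {K : Submodule ℂ H} [FiniteDimensional ℂ K]
    (hK0 : K ≠ ⊥) (hK : ∀ a, ∀ x ∈ K, π a x ∈ K) :
    ∃ (M : Submodule ℂ H) (_ : FiniteDimensional ℂ M) (hM : ∀ a, ∀ x ∈ M, π a x ∈ M),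
      IsIrreducibleRep (restrictInvariant π M hM) := by
  obtain ⟨M, ⟨_, hM0, hM⟩, hmin⟩ := exists_minimalFor_of_wellFoundedLT
    (fun M : Submodule ℂ H => FiniteDimensional ℂ M ∧ M ≠ ⊥ ∧ ∀ a, ∀ x ∈ M, π a x ∈ M)
    (fun M => Module.finrank ℂ M) ⟨K, inferInstance, hK0, hK⟩
  refine ⟨M, inferInstance, hM, Submodule.nontrivial_iff_ne_bot.2 hM0, fun N _ hN => ?_⟩
  refine or_iff_not_imp_left.2 fun hN0 => Submodule.eq_top_of_finrank_eq
    ((Submodule.finrank_le N).antisymm ?_)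
  have hmap : Module.finrank ℂ (N.map M.subtype) = Module.finrank ℂ N := M.finrank_map_subtype_eq N
  rw [← hmap]
  refine hmin ⟨inferInstance, fun hbot => hN0 (Submodule.map_injective_of_injective
    M.subtype_injective (hbot.trans (Submodule.map_bot _).symm)), ?_⟩
    (hmap.trans_le (Submodule.finrank_le N))
  rintro a _ ⟨x, hx, rfl⟩
  exact ⟨_, hN a x hx, rfl⟩

/-- A factor representation: no nontrivial closed subspace is invariant under both the
representation and its commutant. -/
def IsFactorRep (π : A →⋆ₐ[ℂ] (H →L[ℂ] H)) : Prop :=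
  ∀ M : Submodule ℂ H, IsClosed (M : Set H) → (∀ a, ∀ x ∈ M, π a x ∈ M) →
    (∀ T : H →L[ℂ] H, (∀ a, Commute T (π a)) → ∀ x ∈ M, T x ∈ M) → M = ⊥ ∨ M = ⊤

namespace IsFactorRep

variable (hπ : IsFactorRep π)
include hπ

theorem apply_eq_zero {x : H} (hx : x ≠ 0) {a : A} (h : ∀ b, π (a * b) x = 0) : π a = 0 := by
  let M : Submodule ℂ H := ⨅ b, LinearMap.ker (π (a * b)).toLinearMap
  have mem_M {y : H} : y ∈ M ↔ ∀ b, π (a * b) y = 0 := by simp [M]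
  have hclosed : IsClosed (M : Set H) := by
    rw [Submodule.coe_iInf]
    exact isClosed_iInter fun b => (π (a * b)).isClosed_ker
  have htop : M = ⊤ := (hπ M hclosed ?_ ?_).resolve_left
    ((Submodule.ne_bot_iff M).2 ⟨x, mem_M.2 h, hx⟩)
  · ext y
    simpa using mem_M.1 (htop ▸ Submodule.mem_top : y ∈ M) 1
  · intro c y hy
    refine mem_M.2 fun b => ?_
    simpa [mul_assoc] using mem_M.1 hy (b * c)
  · intro T hT y hy
    exact mem_M.2 fun b => (DFunLike.congr_fun (hT (a * b)).eq y).symm.trans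
      ((congrArg T (mem_M.1 hy b)).trans (map_zero T))

theorem exists_mul_mul_notMem_ker {a b : A} (ha : a ∉ RingHom.ker π) (hb : b ∉ RingHom.ker π) :
    ∃ c, a * c * b ∉ RingHom.ker π := by
  by_contra! h
  obtain ⟨y, hy⟩ : ∃ y, π b y ≠ 0 := by
    by_contra! hzero
    exact hb (ContinuousLinearMap.ext hzero)
  refine ha (hπ.apply_eq_zero hy fun c => ?_)
  simpa [map_mul] using DFunLike.congr_fun (h c) y

theorem exists_primOfDim_eq_ker_of_invariant {K : Submodule ℂ H} [FiniteDimensional ℂ K]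
    (hK0 : K ≠ ⊥) (hK : ∀ a, ∀ x ∈ K, π a x ∈ K) :
    ∃ (d : ℕ) (P : primOfDim A d), P.1.1 = RingHom.ker π := by
  obtain ⟨M, _, hM, hirr⟩ := exists_isIrreducibleRep_restrictInvariant hK0 hK
  have := hirr.nontrivial
  obtain ⟨ρ, hρ, hρker⟩ := hirr.exists_surjective_of_finrank_eq
    (E := StdHilbert.{u} (Module.finrank ℂ M)) (finrank_stdHilbert _).symm
  have : Nontrivial (StdHilbert.{u} (Module.finrank ℂ M)) :=
    Module.nontrivial_of_finrank_pos (R := ℂ) ((finrank_stdHilbert _).symm ▸ Module.finrank_pos)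
  refine ⟨_, irrSpace.toPrim (finrank_stdHilbert _) ⟨ρ, hρ⟩, hρker.trans (le_antisymm ?_ ?_)⟩
  · intro a ha
    obtain ⟨x, hx⟩ := exists_ne (0 : M)
    refine hπ.apply_eq_zero (Submodule.coe_eq_zero.not.2 hx) fun b => ?_
    rw [← coe_restrictInvariant_apply M hM, map_mul, show restrictInvariant π M hM a = 0 from ha,
      zero_mul, zero_apply, ZeroMemClass.coe_zero]
  · intro a ha
    ext x
    simp [coe_restrictInvariant_apply, show π a = 0 from ha]

variable [Nontrivial H]

theorem exists_repSpace_ker_le (hA : IsSubhomogeneous A) :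
    ∃ (k : ℕ) (ρ : RepSpace A (StdHilbert.{u} k)), RingHom.ker ρ ≤ RingHom.ker π := by
  by_contra! hcon
  have exists_vanishing (k : ℕ) :
      ∃ y ∉ RingHom.ker π, ∀ ρ : RepSpace A (StdHilbert.{u} k), ρ y = 0 := by
    by_contra! h
    obtain ⟨ρ, -, hρ⟩ := RepSpace.exists_ker_le_of_isCompact (E := StdHilbert.{u} k)
      (fun a b ha hb => hπ.exists_mul_mul_notMem_ker ha hb) isCompact_univ fun a ha => by
        by_contra hπa
        obtain ⟨ρ, hρ⟩ := h a hπa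
        exact hρ (ha ρ trivial)
    exact hcon k ρ hρ
  have exists_vanishing_lt (n : ℕ) :
      ∃ y ∉ RingHom.ker π, ∀ k < n, ∀ ρ : RepSpace A (StdHilbert.{u} k), ρ y = 0 := by
    induction n with
    | zero => exact ⟨1, by simp [RingHom.mem_ker], by simp⟩
    | succ n ih =>
      obtain ⟨y, hy, hyn⟩ := ih
      obtain ⟨z, hz, hzn⟩ := exists_vanishing n
      obtain ⟨c, hc⟩ := hπ.exists_mul_mul_notMem_ker hy hz
      refine ⟨_, hc, fun k hk ρ => ?_⟩
      rcases Nat.lt_succ_iff_lt_or_eq.1 hk with hk | rfl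
      · simp [map_mul, hyn k hk ρ]
      · simp [map_mul, hzn ρ]
  obtain ⟨N, hN⟩ := hA
  obtain ⟨y, hy, hyN⟩ := exists_vanishing_lt (N + 1)
  obtain ⟨φ, hφ, hφy⟩ := exists_isIrreducibleRep_apply_ne_zero (x := y)
    (by rintro rfl; exact hy (zero_mem _))
  obtain ⟨_, hle⟩ := hN φ.Space φ.rep hφ
  obtain ⟨ρ, -, hρ⟩ := hφ.exists_surjective_of_finrank_eq
    (E := StdHilbert.{u} (Module.finrank ℂ φ.Space)) (finrank_stdHilbert _).symm
  exact hφy (hρ.le (hyN _ (Nat.lt_succ_of_le hle) ρ))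

theorem exists_primOfDim_eq_ker_of_isSubhomogeneous (hA : IsSubhomogeneous A) :
    ∃ (d : ℕ) (P : primOfDim A d), P.1.1 = RingHom.ker π := by
  obtain ⟨k, ρ, hρ⟩ := hπ.exists_repSpace_ker_le hA
  obtain ⟨K, _, hK0, hK⟩ := exists_finiteDimensional_invariant_of_ker_le
    (ρ := (ρ : A →ₐ[ℂ] (StdHilbert.{u} k →L[ℂ] StdHilbert.{u} k))) hρ
  exact hπ.exists_primOfDim_eq_ker_of_invariant hK0 hK

end IsFactorRep

end Factor

/-! ### Elementary tensors -/

section OpTensor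

variable {H K : Type*} [NormedAddCommGroup H] [InnerProductSpace ℂ H]
  [NormedAddCommGroup K] [InnerProductSpace ℂ K]

theorem opTensor_coe (T : H →L[ℂ] H) (U : K →L[ℂ] K) (x : H ⊗[ℂ] K) :
    opTensor T U (x : HilbertTensor H K) =
      ((TensorProduct.mapL T U x : H ⊗[ℂ] K) : HilbertTensor H K) :=
  ContinuousLinearMap.completion_apply_coe _ _

theorem HilbertTensor.clm_ext {T U : HilbertTensor H K →L[ℂ] HilbertTensor H K}
    (h : ∀ x : H ⊗[ℂ] K, T (x : HilbertTensor H K) = U (x : HilbertTensor H K)) : T = U := by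
  ext x
  induction x using UniformSpace.Completion.induction_on with
  | hp => exact isClosed_eq (by fun_prop) (by fun_prop)
  | ih x => exact h x

theorem opTensor_mul (T T' : H →L[ℂ] H) (U U' : K →L[ℂ] K) :
    opTensor (T * T') (U * U') = opTensor T U * opTensor T' U' :=
  HilbertTensor.clm_ext fun x => by
    simp only [opTensor_coe, TensorProduct.mapL_mul, mul_apply_eq_comp]

theorem opTensor_one : opTensor (1 : H →L[ℂ] H) (1 : K →L[ℂ] K) = 1 :=
  HilbertTensor.clm_ext fun x => by
    rw [opTensor_coe, ContinuousLinearMap.one_def, ContinuousLinearMap.one_def,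
      TensorProduct.mapL_id_id, ContinuousLinearMap.id_apply, one_apply_eq_self]

theorem opTensor_add_left (T T' : H →L[ℂ] H) (U : K →L[ℂ] K) :
    opTensor (T + T') U = opTensor T U + opTensor T' U :=
  HilbertTensor.clm_ext fun x => by
    simp only [opTensor_coe, add_apply, TensorProduct.mapL_add_left,
      UniformSpace.Completion.coe_add]

theorem opTensor_add_right (T : H →L[ℂ] H) (U U' : K →L[ℂ] K) :
    opTensor T (U + U') = opTensor T U + opTensor T U' :=
  HilbertTensor.clm_ext fun x => by
    simp only [opTensor_coe, add_apply, TensorProduct.mapL_add_right,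
      UniformSpace.Completion.coe_add]

theorem opTensor_smul_left (r : ℂ) (T : H →L[ℂ] H) (U : K →L[ℂ] K) :
    opTensor (r • T) U = r • opTensor T U :=
  HilbertTensor.clm_ext fun x => by
    simp only [opTensor_coe, smul_apply, TensorProduct.mapL_smul_left,
      UniformSpace.Completion.coe_smul]

theorem opTensor_smul_right (r : ℂ) (T : H →L[ℂ] H) (U : K →L[ℂ] K) :
    opTensor T (r • U) = r • opTensor T U :=
  HilbertTensor.clm_ext fun x => by
    simp only [opTensor_coe, smul_apply, TensorProduct.mapL_smul_right,
      UniformSpace.Completion.coe_smul]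

variable [CompleteSpace H] [CompleteSpace K]

theorem inner_mapL_star_left (T : H →L[ℂ] H) (U : K →L[ℂ] K) (x y : H ⊗[ℂ] K) :
    inner ℂ (TensorProduct.mapL (star T) (star U) x) y = inner ℂ x (TensorProduct.mapL T U y) := by
  induction x with
  | zero => simp
  | add x x' hx hx' => rw [map_add, inner_add_left, inner_add_left, hx, hx']
  | tmul a b =>
    induction y with
    | zero => simp
    | add y y' hy hy' => rw [map_add, inner_add_right, inner_add_right, hy, hy']
    | tmul c d =>
      simp [ContinuousLinearMap.star_eq_adjoint, ContinuousLinearMap.adjoint_inner_left]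

theorem opTensor_star (T : H →L[ℂ] H) (U : K →L[ℂ] K) :
    opTensor (star T) (star U) = star (opTensor T U) := by
  rw [ContinuousLinearMap.star_eq_adjoint (opTensor T U), ContinuousLinearMap.eq_adjoint_iff]
  intro x y
  induction x, y using UniformSpace.Completion.induction_on₂ with
  | hp => exact isClosed_eq (by fun_prop) (by fun_prop)
  | ih x y =>
    rw [opTensor_coe, opTensor_coe, UniformSpace.Completion.inner_coe,
      UniformSpace.Completion.inner_coe, inner_mapL_star_left]

end OpTensor

namespace CStarTensor

variable {C : Type u} {S : Type v} [CStarAlgebra C] [CStarAlgebra S]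

/-- The representation of `C ⊗ S` on the tensor product of two GNS spaces. -/
def evalHom (φ : CStarState C) (ψ : CStarState S) :
    CStarTensor C S →⋆ₐ[ℂ] (HilbertTensor φ.Space ψ.Space →L[ℂ] HilbertTensor φ.Space ψ.Space) where
  toFun x := x.1 (φ, ψ)
  map_one' := rfl
  map_mul' _ _ := rfl
  map_zero' := rfl
  map_add' _ _ := rfl
  commutes' _ := rfl
  map_star' _ := rfl

theorem ext_evalHom {x y : CStarTensor C S} (h : ∀ φ ψ, evalHom φ ψ x = evalHom φ ψ y) : x = y :=
  Subtype.ext (Subtype.ext (funext fun p => h p.1 p.2))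

/-- The elementary tensor `c ⊗ s` as an element of `C ⊗ S`. -/
def tmul (c : C) (s : S) : CStarTensor C S :=
  ⟨elemTensor c s, subset_closure (StarAlgebra.subset_adjoin ℂ _ ⟨c, s, rfl⟩)⟩

theorem evalHom_tmul (φ : CStarState C) (ψ : CStarState S) (c : C) (s : S) :
    evalHom φ ψ (tmul c s) = opTensor (φ.rep c) (ψ.rep s) := rfl

theorem tmul_mul_tmul (c c' : C) (s s' : S) : tmul c s * tmul c' s' = tmul (c * c') (s * s') :=
  ext_evalHom fun φ ψ => by simp only [map_mul, evalHom_tmul, opTensor_mul]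

theorem star_tmul (c : C) (s : S) : star (tmul c s) = tmul (star c) (star s) :=
  ext_evalHom fun φ ψ => by simp only [map_star, evalHom_tmul, opTensor_star]

theorem one_tmul_one : tmul (1 : C) (1 : S) = 1 :=
  ext_evalHom fun φ ψ => by simp only [map_one, evalHom_tmul, opTensor_one]

theorem add_tmul (c c' : C) (s : S) : tmul (c + c') s = tmul c s + tmul c' s :=
  ext_evalHom fun φ ψ => by simp only [map_add, evalHom_tmul, opTensor_add_left]

theorem tmul_add (c : C) (s s' : S) : tmul c (s + s') = tmul c s + tmul c s' :=
  ext_evalHom fun φ ψ => by simp only [map_add, evalHom_tmul, opTensor_add_right]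

theorem smul_tmul (r : ℂ) (c : C) (s : S) : tmul (r • c) s = r • tmul c s :=
  ext_evalHom fun φ ψ => by simp only [map_smul, evalHom_tmul, opTensor_smul_left]

theorem tmul_smul (r : ℂ) (c : C) (s : S) : tmul c (r • s) = r • tmul c s :=
  ext_evalHom fun φ ψ => by simp only [map_smul, evalHom_tmul, opTensor_smul_right]

variable (C S) in
/-- The embedding `c ↦ c ⊗ 1`. -/
def inl : C →⋆ₐ[ℂ] CStarTensor C S where
  toFun c := tmul c 1
  map_one' := one_tmul_one
  map_mul' a b := by rw [tmul_mul_tmul, one_mul]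
  map_zero' := by simpa using smul_tmul (0 : ℂ) (0 : C) (1 : S)
  map_add' a b := add_tmul a b 1
  commutes' r := by
    rw [Algebra.algebraMap_eq_smul_one, smul_tmul, one_tmul_one, Algebra.algebraMap_eq_smul_one]
  map_star' a := by rw [star_tmul, star_one]

variable (C S) in
/-- The embedding `s ↦ 1 ⊗ s`. -/
def inr : S →⋆ₐ[ℂ] CStarTensor C S where
  toFun s := tmul 1 s
  map_one' := one_tmul_one
  map_mul' a b := by rw [tmul_mul_tmul, one_mul]
  map_zero' := by simpa using tmul_smul (0 : ℂ) (1 : C) (0 : S)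
  map_add' a b := tmul_add 1 a b
  commutes' r := by
    rw [Algebra.algebraMap_eq_smul_one, tmul_smul, one_tmul_one, Algebra.algebraMap_eq_smul_one]
  map_star' a := by rw [star_tmul, star_one]

theorem inl_mul_inr (c : C) (s : S) : inl C S c * inr C S s = tmul c s :=
  (tmul_mul_tmul c 1 1 s).trans (by rw [mul_one, one_mul])

theorem inr_mul_inl (c : C) (s : S) : inr C S s * inl C S c = tmul c s :=
  (tmul_mul_tmul 1 c s 1).trans (by rw [mul_one, one_mul])

theorem mem_of_forall_tmul_mem {M : Submodule ℂ (CStarTensor C S)}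
    (hM : IsClosed (M : Set (CStarTensor C S))) (h : ∀ c s, tmul c s ∈ M) (x : CStarTensor C S) :
    x ∈ M := by
  let elementary : Submonoid (GNSTensorProd C S) :=
    { carrier := {y | ∃ c s, (tmul c s : CStarTensor C S).1 = y}
      one_mem' := ⟨1, 1, congrArg Subtype.val one_tmul_one⟩
      mul_mem' := by
        rintro _ _ ⟨c, s, rfl⟩ ⟨c', s', rfl⟩
        exact ⟨_, _, (congrArg Subtype.val (tmul_mul_tmul c c' s s')).symm⟩ }
  let val : CStarTensor C S →ₗ[ℂ] GNSTensorProd C S :=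
    (spatialTensor C S).subtype.toAlgHom.toLinearMap
  have hclosure : Submonoid.closure ({y | ∃ (c : C) (s : S), y = elemTensor c s} ∪
      star {y | ∃ (c : C) (s : S), y = elemTensor c s}) ≤ elementary := by
    refine Submonoid.closure_le.2 (Set.union_subset ?_ ?_)
    · rintro _ ⟨c, s, rfl⟩
      exact ⟨c, s, rfl⟩
    · rintro y ⟨c, s, hy⟩
      refine ⟨star c, star s, ?_⟩
      rw [← star_star y, hy, ← star_tmul]
      rfl
  have hadjoin : (StarAlgebra.adjoin ℂ {y | ∃ (c : C) (s : S), y = elemTensor c s} :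
      Set (GNSTensorProd C S)) ⊆ Subtype.val '' (M : Set (CStarTensor C S)) := by
    intro y hy
    have hmap : y ∈ M.map val := by
      refine Submodule.span_le.2 ?_ ((StarAlgebra.adjoin_eq_span _).le hy)
      intro z hz
      obtain ⟨c, s, rfl⟩ := hclosure hz
      exact ⟨_, h c s, rfl⟩
    exact hmap
  have hx : x ∈ closure (M : Set (CStarTensor C S)) := closure_subtype.2 (closure_mono hadjoin x.2)
  exact hM.closure_subset hx

end CStarTensor

/-! ### Tensor products of finite-dimensional irreducible representations -/

theorem exists_linearIsometryEquiv_of_norm_eq {𝕜 V E F : Type*} [NormedField 𝕜] [AddCommGroup V]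
    [Module 𝕜 V] [NormedAddCommGroup E] [NormedSpace 𝕜 E] [CompleteSpace E] [NormedAddCommGroup F]
    [NormedSpace 𝕜 F] {f : V →ₗ[𝕜] E} {g : V →ₗ[𝕜] F} (hf : Function.Surjective f)
    (hg : DenseRange g) (h : ∀ v, ‖g v‖ = ‖f v‖) : ∃ U : E ≃ₗᵢ[𝕜] F, ∀ v, U (f v) = g v := by
  obtain ⟨s, hs⟩ := f.exists_rightInverse_of_surjective (LinearMap.range_eq_top.2 hf)
  have hfs (x : E) : f (s x) = x := LinearMap.congr_fun hs x
  let U : E →ₗᵢ[𝕜] F := ⟨g ∘ₗ s, fun x => by rw [LinearMap.comp_apply, h, hfs]⟩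
  have hU (v : V) : U (f v) = g v := by
    change g (s (f v)) = g v
    rw [← sub_eq_zero, ← map_sub, ← norm_eq_zero, h, map_sub, hfs, sub_self, norm_zero]
  have hdense : DenseRange U := hg.mono (by rintro _ ⟨v, rfl⟩; exact ⟨f v, hU v⟩)
  have hsurj : Function.Surjective U := by
    rw [← Set.range_eq_univ, ← U.isometry.isClosedEmbedding.isClosed_range.closure_eq,
      hdense.closure_range]
  exact ⟨.ofSurjective U hsurj, hU⟩

theorem exists_gns_equiv {A : Type u} [CStarAlgebra A] {E : Type*} [NormedAddCommGroup E]
    [InnerProductSpace ℂ E] [CompleteSpace E] [Nontrivial E] {π : A →⋆ₐ[ℂ] (E →L[ℂ] E)}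
    (hπ : Function.Surjective π) :
    ∃ (φ : CStarState A) (U : E ≃ₗᵢ[ℂ] φ.Space), ∀ a x, U (π a x) = φ.rep a (U x) := by
  obtain ⟨ξ, hξ⟩ := exists_norm_eq E zero_le_one
  let φ := CStarState.ofMemStateSet (vectorState_mem_stateSet π hξ)
  let f : A →ₗ[ℂ] E := (ContinuousLinearMap.apply ℂ E ξ).toLinearMap ∘ₗ (π : A →ₗ[ℂ] _)
  let g : A →ₗ[ℂ] φ.Space :=
    (ContinuousLinearMap.apply ℂ φ.Space φ.vec).toLinearMap ∘ₗ (φ.rep : A →ₗ[ℂ] _)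
  have hnorm (a : A) : ‖g a‖ = ‖f a‖ := by
    have hinner : inner ℂ (g a) (g a) = inner ℂ (f a) (f a) := by
      change inner ℂ (φ.rep a φ.vec) (φ.rep a φ.vec) = inner ℂ (π a ξ) (π a ξ)
      rw [φ.inner_rep_vec, inner_rep_apply_left]
      change inner ℂ ξ (π (star a * a) ξ) = _
      rw [map_mul]
      rfl
    rw [norm_eq_sqrt_re_inner (𝕜 := ℂ), norm_eq_sqrt_re_inner (𝕜 := ℂ), hinner]
  have hsurj : Function.Surjective f := fun y => by
    obtain ⟨a, ha⟩ := hπ (InnerProductSpace.rankOne ℂ y ξ)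
    refine ⟨a, ?_⟩
    change π a ξ = y
    rw [ha, InnerProductSpace.rankOne_apply, inner_self_eq_norm_sq_to_K, hξ]
    simp
  obtain ⟨U, hU⟩ := exists_linearIsometryEquiv_of_norm_eq hsurj φ.denseRange_rep_vec hnorm
  refine ⟨φ, U, fun a x => ?_⟩
  obtain ⟨b, rfl⟩ := hsurj x
  have hf : π a (f b) = f (a * b) := by simp [f]
  have hg : φ.rep a (g b) = g (a * b) := by simp [g]
  rw [hf, hU, hU, hg]

section TensorRep

variable {E F : Type*} [NormedAddCommGroup E] [InnerProductSpace ℂ E]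
  [NormedAddCommGroup F] [InnerProductSpace ℂ F] [FiniteDimensional ℂ E] [FiniteDimensional ℂ F]

instance : CompleteSpace (E ⊗[ℂ] F) := FiniteDimensional.complete ℂ _

instance [Nontrivial E] [Nontrivial F] : Nontrivial (E ⊗[ℂ] F) :=
  Module.nontrivial_of_finrank_pos (R := ℂ) (by
    rw [Module.finrank_tensorProduct]
    exact Nat.mul_pos Module.finrank_pos Module.finrank_pos)

variable (E F) in
/-- The identification of `B(E) ⊗ B(F)` with `B(E ⊗ F)` for finite-dimensional `E` and `F`. -/
def endTensorEquiv : (E →L[ℂ] E) ⊗[ℂ] (F →L[ℂ] F) ≃ₗ[ℂ] (E ⊗[ℂ] F →L[ℂ] E ⊗[ℂ] F) :=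
  (TensorProduct.congr LinearMap.toContinuousLinearMap.symm
    LinearMap.toContinuousLinearMap.symm).trans
    ((homTensorHomEquiv ℂ E F E F).trans LinearMap.toContinuousLinearMap)

theorem endTensorEquiv_tmul (T : E →L[ℂ] E) (U : F →L[ℂ] F) :
    endTensorEquiv E F (T ⊗ₜ U) = TensorProduct.mapL T U := by
  apply ContinuousLinearMap.coe_injective
  rw [TensorProduct.toLinearMap_mapL]
  simp [endTensorEquiv]

variable [CompleteSpace E] [CompleteSpace F]
  {C : Type u} {S : Type v} [CStarAlgebra C] [CStarAlgebra S]
  {π : C →⋆ₐ[ℂ] (E →L[ℂ] E)} {κ : S →⋆ₐ[ℂ] (F →L[ℂ] F)}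
  (hπ : Function.Surjective π) (hκ : Function.Surjective κ)
include hπ hκ

theorem surjective_of_forall_apply_tmul {ρ : CStarTensor C S →⋆ₐ[ℂ] (E ⊗[ℂ] F →L[ℂ] E ⊗[ℂ] F)}
    (hρ : ∀ c s, ρ (CStarTensor.tmul c s) = TensorProduct.mapL (π c) (κ s)) :
    Function.Surjective ρ := by
  intro X
  obtain ⟨t, rfl⟩ := (endTensorEquiv E F).surjective X
  induction t with
  | zero => exact ⟨0, by simp⟩
  | add x y hx hy =>
    obtain ⟨a, ha⟩ := hx
    obtain ⟨b, hb⟩ := hy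
    exact ⟨a + b, by rw [map_add, map_add, ha, hb]⟩
  | tmul T U =>
    obtain ⟨c, rfl⟩ := hπ T
    obtain ⟨s, rfl⟩ := hκ U
    exact ⟨_, (hρ c s).trans (endTensorEquiv_tmul _ _).symm⟩

variable [Nontrivial E] [Nontrivial F]

theorem exists_apply_tmul_eq_mapL :
    ∃ ρ : CStarTensor C S →⋆ₐ[ℂ] (E ⊗[ℂ] F →L[ℂ] E ⊗[ℂ] F),
      ∀ c s, ρ (CStarTensor.tmul c s) = TensorProduct.mapL (π c) (κ s) := by
  obtain ⟨φ, U, hU⟩ := exists_gns_equiv hπ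
  obtain ⟨ψ, V, hV⟩ := exists_gns_equiv hκ
  let W₀ : E ⊗[ℂ] F →ₗᵢ[ℂ] HilbertTensor φ.Space ψ.Space :=
    (UniformSpace.Completion.toComplₗᵢ (𝕜 := ℂ) (E := φ.Space ⊗[ℂ] ψ.Space)).comp
      (TensorProduct.congrIsometry U V).toLinearIsometry
  have hdense : DenseRange W₀ := UniformSpace.Completion.denseRange_coe.comp
    (TensorProduct.congrIsometry U V).surjective.denseRange
    (UniformSpace.Completion.continuous_coe _)
  obtain ⟨W, hWW₀⟩ := exists_linearIsometryEquiv_of_norm_eq (f := .id (R := ℂ))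
    (g := W₀.toLinearMap) Function.surjective_id hdense W₀.norm_map
  have hW (x : E) (y : F) : W (x ⊗ₜ y) =
      ((U x ⊗ₜ[ℂ] V y : φ.Space ⊗[ℂ] ψ.Space) : HilbertTensor φ.Space ψ.Space) := hWW₀ _
  refine ⟨conjRep W.symm (CStarTensor.evalHom φ ψ), fun c s => ?_⟩
  apply ContinuousLinearMap.coe_injective
  refine TensorProduct.ext' fun x y => ?_
  rw [ContinuousLinearMap.coe_coe, ContinuousLinearMap.coe_coe, conjRep_apply,
    LinearIsometryEquiv.symm_symm, CStarTensor.evalHom_tmul, TensorProduct.mapL_tmul,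
    LinearIsometryEquiv.symm_apply_eq, hW, hW, opTensor_coe, TensorProduct.mapL_tmul, hU, hV]

theorem ker_eq_of_forall_apply_tmul {ρ : CStarTensor C S →⋆ₐ[ℂ] (E ⊗[ℂ] F →L[ℂ] E ⊗[ℂ] F)}
    (hρ : ∀ c s, ρ (CStarTensor.tmul c s) = TensorProduct.mapL (π c) (κ s))
    {D : Type*} [CStarAlgebra D] [Nontrivial D] {σ : CStarTensor C S →⋆ₐ[ℂ] D}
    (hσπ : RingHom.ker π ≤ RingHom.ker (σ.comp (CStarTensor.inl C S)))
    (hσκ : RingHom.ker κ ≤ RingHom.ker (σ.comp (CStarTensor.inr C S))) :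
    RingHom.ker ρ = RingHom.ker σ := by
  have := isSimpleRing_continuousEnd (E := E)
  have := isSimpleRing_continuousEnd (E := F)
  have := isSimpleRing_continuousEnd (E := E ⊗[ℂ] F)
  obtain ⟨θ, -, hθ⟩ := exists_injective_algHom_apply_eq_of_ker_le
    (ρ := (π : C →ₐ[ℂ] (E →L[ℂ] E))) hπ
    (σ := (σ.comp (CStarTensor.inl C S) : C →ₐ[ℂ] D)) hσπ
  obtain ⟨θ', -, hθ'⟩ := exists_injective_algHom_apply_eq_of_ker_le
    (ρ := (κ : S →ₐ[ℂ] (F →L[ℂ] F))) hκ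
    (σ := (σ.comp (CStarTensor.inr C S) : S →ₐ[ℂ] D)) hσκ
  let m : (E ⊗[ℂ] F →L[ℂ] E ⊗[ℂ] F) →ₗ[ℂ] D :=
    TensorProduct.lift ((LinearMap.mul ℂ D).compl₁₂ θ.toLinearMap θ'.toLinearMap) ∘ₗ
      (endTensorEquiv E F).symm.toLinearMap
  have hm (T : E →L[ℂ] E) (U : F →L[ℂ] F) : m (TensorProduct.mapL T U) = θ T * θ' U := by
    simp [m, ← endTensorEquiv_tmul]
  have hclosed : IsClosed {x | m (ρ x) = σ x} :=
    isClosed_eq (m.continuous_of_finiteDimensional.comp (continuous_starAlgHom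
      (A := CStarTensor C S) (D := E ⊗[ℂ] F →L[ℂ] E ⊗[ℂ] F) ρ)) (continuous_starAlgHom σ)
  have hfactor (x : CStarTensor C S) : m (ρ x) = σ x := by
    refine CStarTensor.mem_of_forall_tmul_mem (M := LinearMap.eqLocus
      (m ∘ₗ (ρ : CStarTensor C S →ₐ[ℂ] (E ⊗[ℂ] F →L[ℂ] E ⊗[ℂ] F)).toLinearMap)
      (σ : CStarTensor C S →ₐ[ℂ] D).toLinearMap) hclosed (fun c s => ?_) x
    change m (ρ (CStarTensor.tmul c s)) = σ (CStarTensor.tmul c s)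
    rw [hρ, hm, ← CStarTensor.inl_mul_inr, map_mul]
    exact congrArg₂ (· * ·) (hθ c) (hθ' s)
  refine ker_eq_of_ker_le_of_surjective (surjective_of_forall_apply_tmul hπ hκ hρ) fun x hx => ?_
  rw [RingHom.mem_ker, ← hfactor, show ρ x = 0 from hx, map_zero]

end TensorRep

/-! ### Irreducible representations of a tensor product -/

theorem finrank_continuousEnd (E : Type*) [NormedAddCommGroup E] [InnerProductSpace ℂ E]
    [FiniteDimensional ℂ E] : Module.finrank ℂ (E →L[ℂ] E) = Module.finrank ℂ E ^ 2 := by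
  rw [← LinearMap.toContinuousLinearMap.finrank_eq, Module.finrank_linearMap, sq]

theorem IsIrreducibleRep.finrank_eq_of_ker_eq {A E H : Type*} [CStarAlgebra A]
    [NormedAddCommGroup E] [InnerProductSpace ℂ E] [CompleteSpace E] [FiniteDimensional ℂ E]
    [NormedAddCommGroup H] [InnerProductSpace ℂ H] [CompleteSpace H] [FiniteDimensional ℂ H]
    {ρ : A →⋆ₐ[ℂ] (E →L[ℂ] E)} (hρ : IsIrreducibleRep ρ) {σ : A →⋆ₐ[ℂ] (H →L[ℂ] H)}
    (hσ : IsIrreducibleRep σ) (h : RingHom.ker ρ = RingHom.ker σ) :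
    Module.finrank ℂ E = Module.finrank ℂ H := by
  have hker : LinearMap.ker (ρ : A →ₗ[ℂ] (E →L[ℂ] E)) = LinearMap.ker (σ : A →ₗ[ℂ] (H →L[ℂ] H)) :=
    Submodule.ext fun a => SetLike.ext_iff.1 h a
  have hsq := ((LinearMap.quotKerEquivOfSurjective (ρ : A →ₗ[ℂ] (E →L[ℂ] E))
    hρ.surjective).symm.trans ((Submodule.quotEquivOfEq _ _ hker).trans
      (LinearMap.quotKerEquivOfSurjective (σ : A →ₗ[ℂ] (H →L[ℂ] H)) hσ.surjective))).finrank_eq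
  rw [finrank_continuousEnd, finrank_continuousEnd] at hsq
  exact Nat.pow_left_injective two_ne_zero hsq

section Decomposition

variable {C : Type u} {S : Type v} [CStarAlgebra C] [CStarAlgebra S] {H : Type*}
  [NormedAddCommGroup H] [InnerProductSpace ℂ H] [CompleteSpace H]
  {σ : CStarTensor C S →⋆ₐ[ℂ] (H →L[ℂ] H)}

namespace IsIrreducibleRep

variable (hσ : IsIrreducibleRep σ)
include hσ

theorem eq_bot_or_eq_top_of_tmul {M : Submodule ℂ H} (hM : IsClosed (M : Set H))
    (h : ∀ c s, ∀ x ∈ M, σ (CStarTensor.tmul c s) x ∈ M) : M = ⊥ ∨ M = ⊤ := by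
  refine hσ.eq_bot_or_eq_top M hM fun a x hx => ?_
  exact CStarTensor.mem_of_forall_tmul_mem
    (M := M.comap ((ContinuousLinearMap.apply ℂ H x).toLinearMap ∘ₗ
      (σ : CStarTensor C S →ₐ[ℂ] (H →L[ℂ] H)).toLinearMap))
    (hM.preimage ((ContinuousLinearMap.apply ℂ H x).continuous.comp (continuous_starAlgHom σ)))
    (fun c s => h c s x hx) a

theorem isFactorRep_inl : IsFactorRep (σ.comp (CStarTensor.inl C S)) := by
  intro M hM hinv hcomm
  refine hσ.eq_bot_or_eq_top_of_tmul hM fun c s x hx => ?_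
  rw [← CStarTensor.inl_mul_inr, map_mul]
  refine hinv c _ (hcomm _ (fun c => ?_) x hx)
  exact Commute.map ((CStarTensor.inr_mul_inl c s).trans (CStarTensor.inl_mul_inr c s).symm) σ

theorem isFactorRep_inr : IsFactorRep (σ.comp (CStarTensor.inr C S)) := by
  intro M hM hinv hcomm
  refine hσ.eq_bot_or_eq_top_of_tmul hM fun c s x hx => ?_
  rw [← CStarTensor.inr_mul_inl, map_mul]
  refine hinv s _ (hcomm _ (fun s => ?_) x hx)
  exact Commute.map ((CStarTensor.inl_mul_inr c s).trans (CStarTensor.inr_mul_inl c s).symm) σ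

theorem exists_primOfDim_eq_ker_of_finiteDimensional [FiniteDimensional ℂ H] :
    ∃ (k l : ℕ) (P : primOfDim C k) (Q : primOfDim S l),
      P.1.1 = RingHom.ker (σ.comp (CStarTensor.inl C S)) ∧
        Q.1.1 = RingHom.ker (σ.comp (CStarTensor.inr C S)) := by
  have := hσ.nontrivial
  obtain ⟨k, P, hP⟩ := hσ.isFactorRep_inl.exists_primOfDim_eq_ker_of_invariant top_ne_bot
    fun _ _ _ => trivial
  obtain ⟨l, Q, hQ⟩ := hσ.isFactorRep_inr.exists_primOfDim_eq_ker_of_invariant top_ne_bot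
    fun _ _ _ => trivial
  exact ⟨k, l, P, Q, hP, hQ⟩

theorem finiteDimensional_and_finrank_eq_mul {k l : ℕ} {P : primOfDim C k} {Q : primOfDim S l}
    (hP : P.1.1 = RingHom.ker (σ.comp (CStarTensor.inl C S)))
    (hQ : Q.1.1 = RingHom.ker (σ.comp (CStarTensor.inr C S))) :
    FiniteDimensional ℂ H ∧ Module.finrank ℂ H = k * l := by
  obtain ⟨P, E, _, _, _, π, hπ, _, rfl, hπP⟩ := P
  obtain ⟨Q, F, _, _, _, κ, hκ, _, rfl, hκQ⟩ := Q
  have := hπ.nontrivial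
  have := hκ.nontrivial
  have := hσ.nontrivial
  obtain ⟨ρ, hρ⟩ := exists_apply_tmul_eq_mapL hπ.surjective hκ.surjective
  have hker : RingHom.ker ρ = RingHom.ker σ := ker_eq_of_forall_apply_tmul hπ.surjective
    hκ.surjective hρ (hπP.trans hP).le (hκQ.trans hQ).le
  have hρirr : IsIrreducibleRep ρ :=
    .of_surjective (surjective_of_forall_apply_tmul hπ.surjective hκ.surjective hρ)
  obtain ⟨K, _, hK0, hK⟩ := exists_finiteDimensional_invariant_of_ker_le
    (ρ := (ρ : CStarTensor C S →ₐ[ℂ] (E ⊗[ℂ] F →L[ℂ] E ⊗[ℂ] F))) hker.le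
  obtain rfl : K = ⊤ :=
    (hσ.eq_bot_or_eq_top K (Submodule.closed_of_finiteDimensional K) hK).resolve_left hK0
  have hfin : FiniteDimensional ℂ H := Submodule.topEquiv.finiteDimensional
  refine ⟨hfin, ?_⟩
  rw [← hρirr.finrank_eq_of_ker_eq hσ hker, Module.finrank_tensorProduct]

theorem ker_eq_of_ker_comp_eq [FiniteDimensional ℂ H] {D : Type*} [CStarAlgebra D] [Nontrivial D]
    {τ : CStarTensor C S →⋆ₐ[ℂ] D}
    (hl : RingHom.ker (σ.comp (CStarTensor.inl C S)) = RingHom.ker (τ.comp (CStarTensor.inl C S)))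
    (hr : RingHom.ker (σ.comp (CStarTensor.inr C S)) = RingHom.ker (τ.comp (CStarTensor.inr C S))) :
    RingHom.ker σ = RingHom.ker τ := by
  obtain ⟨k, l, ⟨P, E, _, _, _, π, hπ, _, _, hπP⟩, ⟨Q, F, _, _, _, κ, hκ, _, _, hκQ⟩, hP, hQ⟩ :=
    hσ.exists_primOfDim_eq_ker_of_finiteDimensional
  have := hπ.nontrivial
  have := hκ.nontrivial
  have := hσ.nontrivial
  obtain ⟨ρ, hρ⟩ := exists_apply_tmul_eq_mapL hπ.surjective hκ.surjective
  have hσker : RingHom.ker ρ = RingHom.ker σ := ker_eq_of_forall_apply_tmul hπ.surjective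
    hκ.surjective hρ (hπP.trans hP).le (hκQ.trans hQ).le
  have hτker : RingHom.ker ρ = RingHom.ker τ := ker_eq_of_forall_apply_tmul hπ.surjective
    hκ.surjective hρ (hπP.trans (hP.trans hl)).le (hκQ.trans (hQ.trans hr)).le
  exact hσker.symm.trans hτker

end IsIrreducibleRep

theorem IsSubhomogeneous.cstarTensor (hC : IsSubhomogeneous C) (hS : IsSubhomogeneous S) :
    IsSubhomogeneous (CStarTensor C S) := by
  obtain ⟨N, hN⟩ := id hC
  obtain ⟨M, hM⟩ := id hS
  refine ⟨N * M, fun H _ _ _ σ hσ => ?_⟩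
  have := hσ.nontrivial
  obtain ⟨k, P, hP⟩ := hσ.isFactorRep_inl.exists_primOfDim_eq_ker_of_isSubhomogeneous hC
  obtain ⟨l, Q, hQ⟩ := hσ.isFactorRep_inr.exists_primOfDim_eq_ker_of_isSubhomogeneous hS
  obtain ⟨hfin, hfinrank⟩ := hσ.finiteDimensional_and_finrank_eq_mul hP hQ
  obtain ⟨_, E, _, _, _, π, hπ, _, rfl, -⟩ := P
  obtain ⟨_, F, _, _, _, κ, hκ, _, rfl, -⟩ := Q
  exact ⟨hfin, hfinrank ▸ Nat.mul_le_mul (hN E π hπ).2 (hM F κ hκ).2⟩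

theorem primOfDim_cstarTensor_ext {d : ℕ} {R R' : primOfDim (CStarTensor C S) d}
    (hl : R.1.1.comap (CStarTensor.inl C S) = R'.1.1.comap (CStarTensor.inl C S))
    (hr : R.1.1.comap (CStarTensor.inr C S) = R'.1.1.comap (CStarTensor.inr C S)) : R = R' := by
  refine Subtype.ext (Subtype.ext ?_)
  obtain ⟨R, H, _, _, _, σ, hσ, _, _, hR⟩ := R
  obtain ⟨R', H', _, _, _, σ', hσ', _, _, hR'⟩ := R'
  have := hσ'.nontrivial
  rw [← hR, ← hR'] at hl hr ⊢
  exact hσ.ker_eq_of_ker_comp_eq hl hr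

end Decomposition

/-! ### The map `Prim_k C × Prim_l S → Prim_{kl} (C ⊗ S)` -/

section TensorPrim

theorem continuous_mapL {X E F : Type*} [TopologicalSpace X] [NormedAddCommGroup E]
    [InnerProductSpace ℂ E] [NormedAddCommGroup F] [InnerProductSpace ℂ F] {f : X → E →L[ℂ] E}
    {g : X → F →L[ℂ] F} (hf : Continuous f) (hg : Continuous g) :
    Continuous fun x => TensorProduct.mapL (f x) (g x) := by
  have h : IsBoundedBilinearMap ℂ fun p : (E →L[ℂ] E) × (F →L[ℂ] F) =>
      TensorProduct.mapL p.1 p.2 :=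
    { add_left := fun _ _ _ => TensorProduct.mapL_add_left _ _ _
      smul_left := fun _ _ _ => TensorProduct.mapL_smul_left _ _ _
      add_right := fun _ _ _ => TensorProduct.mapL_add_right _ _ _
      smul_right := fun _ _ _ => TensorProduct.mapL_smul_right _ _ _
      bound := ⟨1, one_pos, fun T U => by rw [one_mul]; exact TensorProduct.norm_mapL_le T U⟩ }
  have hcomp := h.continuous.comp (hf.prodMk hg)
  exact hcomp

variable {C : Type u} {S : Type v} [CStarAlgebra C] [CStarAlgebra S]

theorem CStarTensor.continuous_of_tmul {X D : Type*} [TopologicalSpace X] [CStarAlgebra D]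
    {ρ : X → CStarTensor C S →⋆ₐ[ℂ] D} (h : ∀ c s, Continuous fun p => ρ p (CStarTensor.tmul c s))
    (x : CStarTensor C S) : Continuous fun p => ρ p x := by
  let M : Submodule ℂ (CStarTensor C S) :=
    { carrier := {x | Continuous fun p => ρ p x}
      add_mem' ha hb := by simp only [Set.mem_ofPred_eq, map_add] at *; exact ha.add hb
      zero_mem' := by simpa only [Set.mem_ofPred_eq, map_zero] using continuous_const
      smul_mem' r a ha := by simp only [Set.mem_ofPred_eq, map_smul] at *; exact ha.const_smul r }
  refine CStarTensor.mem_of_forall_tmul_mem (M := M) (isClosed_of_closure_subset fun a ha => ?_) h x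
  -- The evaluations are uniformly close to each other on nearby elements, as each `ρ p` contracts.
  change Continuous fun p => ρ p a
  refine continuous_of_uniform_approx_of_continuous fun U hU => ?_
  obtain ⟨ε, hε, hεU⟩ := Metric.mem_uniformity_dist.1 hU
  obtain ⟨b, hb, hab⟩ := Metric.mem_closure_iff.1 ha ε hε
  refine ⟨fun p => ρ p b, hb, fun p => hεU ?_⟩
  rw [dist_eq_norm, ← map_sub]
  exact (NonUnitalStarAlgHom.norm_apply_le (ρ p) _).trans_lt (by rwa [← dist_eq_norm])

section Ker

variable {E F : Type*} [NormedAddCommGroup E] [InnerProductSpace ℂ E] [CompleteSpace E]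
  [NormedAddCommGroup F] [InnerProductSpace ℂ F] [CompleteSpace F] [FiniteDimensional ℂ E]
  [FiniteDimensional ℂ F] [Nontrivial E] [Nontrivial F] {π : C →⋆ₐ[ℂ] (E →L[ℂ] E)}
  {κ : S →⋆ₐ[ℂ] (F →L[ℂ] F)} {ρ : CStarTensor C S →⋆ₐ[ℂ] (E ⊗[ℂ] F →L[ℂ] E ⊗[ℂ] F)}
  (hρ : ∀ c s, ρ (CStarTensor.tmul c s) = TensorProduct.mapL (π c) (κ s))
include hρ

theorem ker_comp_inl_eq_of_forall_apply_tmul (hπ : Function.Surjective π) :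
    RingHom.ker (ρ.comp (CStarTensor.inl C S)) = RingHom.ker π := by
  have := isSimpleRing_continuousEnd (E := E)
  refine (ker_eq_of_ker_le_of_surjective hπ fun c hc => ?_).symm
  exact (hρ c 1).trans (by rw [show π c = 0 from hc, TensorProduct.mapL_zero_left])

theorem ker_comp_inr_eq_of_forall_apply_tmul (hκ : Function.Surjective κ) :
    RingHom.ker (ρ.comp (CStarTensor.inr C S)) = RingHom.ker κ := by
  have := isSimpleRing_continuousEnd (E := F)
  refine (ker_eq_of_ker_le_of_surjective hκ fun s hs => ?_).symm
  exact (hρ 1 s).trans (by rw [show κ s = 0 from hs, TensorProduct.mapL_zero_right])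

end Ker

section IrrSpace

variable {E : Type u} [NormedAddCommGroup E] [InnerProductSpace ℂ E] [CompleteSpace E]
  [FiniteDimensional ℂ E] [Nontrivial E] {F : Type v} [NormedAddCommGroup F]
  [InnerProductSpace ℂ F] [CompleteSpace F] [FiniteDimensional ℂ F] [Nontrivial F]

variable (C S E F) in
theorem exists_continuous_irrSpace_tensor :
    ∃ T : irrSpace C E × irrSpace S F → irrSpace (CStarTensor C S) (E ⊗[ℂ] F), Continuous T ∧
      ∀ p c s, (T p).1 (CStarTensor.tmul c s) = TensorProduct.mapL (p.1.1 c) (p.2.1 s) := by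
  choose ρ hρ using fun p : irrSpace C E × irrSpace S F => exists_apply_tmul_eq_mapL
    (π := show C →⋆ₐ[ℂ] (E →L[ℂ] E) from p.1.1) (κ := show S →⋆ₐ[ℂ] (F →L[ℂ] F) from p.2.1)
    p.1.2 p.2.2
  refine ⟨fun p => ⟨ρ p, surjective_of_forall_apply_tmul p.1.2 p.2.2 (hρ p)⟩,
    .subtype_mk (RepSpace.continuous_iff.2 (CStarTensor.continuous_of_tmul fun c s => ?_)) _, hρ⟩
  simp only [hρ]
  exact continuous_mapL
    ((RepSpace.continuous_apply c).comp (continuous_subtype_val.comp continuous_fst))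
    ((RepSpace.continuous_apply s).comp (continuous_subtype_val.comp continuous_snd))

theorem exists_continuous_primOfDim_tensor_of_finrank {k l : ℕ} (hE : Module.finrank ℂ E = k)
    (hF : Module.finrank ℂ F = l) :
    ∃ Φ : primOfDim C k × primOfDim S l → primOfDim (CStarTensor C S) (k * l), Continuous Φ ∧
      (∀ p, (Φ p).1.1.comap (CStarTensor.inl C S) = p.1.1.1) ∧
        ∀ p, (Φ p).1.1.comap (CStarTensor.inr C S) = p.2.1.1 := by
  have hEF : Module.finrank ℂ (E ⊗[ℂ] F) = k * l := by
    rw [Module.finrank_tensorProduct, hE, hF]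
  obtain ⟨T, hT, hTtmul⟩ := exists_continuous_irrSpace_tensor C S E F
  let q : irrSpace C E × irrSpace S F → primOfDim C k × primOfDim S l :=
    Prod.map (irrSpace.toPrim hE) (irrSpace.toPrim hF)
  have hqs : Function.Surjective q :=
    (irrSpace.surjective_toPrim hE).prodMap (irrSpace.surjective_toPrim hF)
  have hqp : IsProperMap q :=
    (irrSpace.isProperMap_toPrim hE).prodMap (irrSpace.isProperMap_toPrim hF)
  have hq : Topology.IsQuotientMap q := hqp.isClosedMap.isQuotientMap hqp.continuous hqs
  have hl (p) : (irrSpace.toPrim hEF (T p)).1.1.comap (CStarTensor.inl C S) = (q p).1.1.1 :=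
    ker_comp_inl_eq_of_forall_apply_tmul (hTtmul p) p.1.2
  have hr (p) : (irrSpace.toPrim hEF (T p)).1.1.comap (CStarTensor.inr C S) = (q p).2.1.1 :=
    ker_comp_inr_eq_of_forall_apply_tmul (hTtmul p) p.2.2
  let lift := Function.surjInv hqs
  have hlift (p) : q (lift p) = p := Function.surjInv_eq hqs p
  refine ⟨fun p => irrSpace.toPrim hEF (T (lift p)), hq.continuous_iff.2 ?_,
    fun p => by rw [hl, hlift], fun p => by rw [hr, hlift]⟩
  have hcomp : (fun p => irrSpace.toPrim hEF (T (lift p))) ∘ q = irrSpace.toPrim hEF ∘ T :=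
    funext fun p => primOfDim_cstarTensor_ext
      (by rw [Function.comp_apply, hl, hlift]; exact (hl p).symm)
      (by rw [Function.comp_apply, hr, hlift]; exact (hr p).symm)
  rw [hcomp]
  exact (irrSpace.continuous_toPrim hEF).comp hT

end IrrSpace

theorem exists_continuous_primOfDim_tensor (k l : ℕ) :
    ∃ Φ : primOfDim C k × primOfDim S l → primOfDim (CStarTensor C S) (k * l), Continuous Φ ∧
      (∀ p, (Φ p).1.1.comap (CStarTensor.inl C S) = p.1.1.1) ∧
        ∀ p, (Φ p).1.1.comap (CStarTensor.inr C S) = p.2.1.1 := by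
  rcases isEmpty_or_nonempty (primOfDim C k × primOfDim S l) with _ | ⟨⟨P, Q⟩⟩
  · exact ⟨isEmptyElim, continuous_iff_continuousAt.2 isEmptyElim, isEmptyElim, isEmptyElim⟩
  have := nontrivial_stdHilbert P.2
  have := nontrivial_stdHilbert Q.2
  exact exists_continuous_primOfDim_tensor_of_finrank (finrank_stdHilbert.{u} k)
    (finrank_stdHilbert.{v} l)

end TensorPrim

/-! ### The dimension of the primitive spectrum of a tensor product -/

section DimRatio

variable {C : Type u} {S : Type v} [CStarAlgebra C] [CStarAlgebra S]

theorem exists_comap_eq_of_primOfDim_cstarTensor {d : ℕ} (R : primOfDim (CStarTensor C S) d) :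
    ∃ (k l : ℕ) (P : primOfDim C k) (Q : primOfDim S l), k * l = d ∧
      R.1.1.comap (CStarTensor.inl C S) = P.1.1 ∧ R.1.1.comap (CStarTensor.inr C S) = Q.1.1 := by
  obtain ⟨R, H, _, _, _, σ, hσ, _, rfl, hR⟩ := R
  obtain ⟨k, l, P, Q, hP, hQ⟩ := hσ.exists_primOfDim_eq_ker_of_finiteDimensional
  refine ⟨k, l, P, Q, (hσ.finiteDimensional_and_finrank_eq_mul hP hQ).2.symm, ?_, ?_⟩
  · rw [hP, ← hR]; rfl
  · rw [hQ, ← hR]; rfl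

variable [TopologicalSpace.SeparableSpace C] [TopologicalSpace.SeparableSpace S]

theorem coveringDim_primOfDim_cstarTensor_le {d : ℕ} {n : ℕ∞}
    (h : ∀ k l, k * l = d → (primOfDim C k).Nonempty → (primOfDim S l).Nonempty →
      coveringDim (primOfDim C k) + coveringDim (primOfDim S l) ≤ n) :
    coveringDim (primOfDim (CStarTensor C S) d) ≤ n := by
  induction n with
  | top => exact le_top
  | coe n =>
    let I := {p : ℕ × ℕ // p.1 * p.2 = d ∧ (primOfDim C p.1).Nonempty ∧ (primOfDim S p.2).Nonempty}
    have hΦ (i : I) : ∃ Φ : primOfDim C i.1.1 × primOfDim S i.1.2 → primOfDim (CStarTensor C S) d,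
        Continuous Φ ∧ (∀ p, (Φ p).1.1.comap (CStarTensor.inl C S) = p.1.1.1) ∧
          ∀ p, (Φ p).1.1.comap (CStarTensor.inr C S) = p.2.1.1 := by
      obtain ⟨⟨k, l⟩, rfl, -⟩ := i
      exact exists_continuous_primOfDim_tensor k l
    choose Φ hΦc hΦl hΦr using hΦ
    refine coveringDimLE_iff.1 (.of_iUnion_range_prod hΦc (fun i p q hpq => ?_)
      (Set.iUnion_eq_univ_iff.2 fun R => ?_) fun i => h _ _ i.2.1 i.2.2.1 i.2.2.2)
    · exact Prod.ext (Subtype.ext (Subtype.ext (by rw [← hΦl, hpq, hΦl])))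
        (Subtype.ext (Subtype.ext (by rw [← hΦr, hpq, hΦr])))
    · obtain ⟨k, l, P, Q, hkl, hP, hQ⟩ := exists_comap_eq_of_primOfDim_cstarTensor R
      exact ⟨⟨(k, l), hkl, ⟨P.1, P.2⟩, ⟨Q.1, Q.2⟩⟩, (P, Q),
        primOfDim_cstarTensor_ext ((hΦl _ _).trans hP.symm) ((hΦr _ _).trans hQ.symm)⟩

theorem exists_coveringDim_primOfDim_cstarTensor_le {d : ℕ}
    (hd : (primOfDim (CStarTensor C S) d).Nonempty) :
    ∃ k l, k * l = d ∧ (primOfDim C k).Nonempty ∧ (primOfDim S l).Nonempty ∧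
      coveringDim (primOfDim (CStarTensor C S) d) ≤
        coveringDim (primOfDim C k) + coveringDim (primOfDim S l) := by
  let I := {p : ℕ × ℕ | p.1 * p.2 = d ∧ (primOfDim C p.1).Nonempty ∧ (primOfDim S p.2).Nonempty}
  obtain ⟨R, hR⟩ := hd
  have hI : I.Finite := d.divisorsAntidiagonal.finite_toSet.subset fun p hp =>
    Nat.mem_divisorsAntidiagonal.2 ⟨hp.1, (pos_of_mem_primOfDim hR).ne'⟩
  obtain ⟨k, l, P, Q, hkl, -⟩ := exists_comap_eq_of_primOfDim_cstarTensor ⟨R, hR⟩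
  obtain ⟨p, ⟨hp, hpC, hpS⟩, hmax⟩ := Set.exists_max_image I
    (fun p => coveringDim (primOfDim C p.1) + coveringDim (primOfDim S p.2)) hI
    ⟨(k, l), hkl, ⟨P.1, P.2⟩, ⟨Q.1, Q.2⟩⟩
  exact ⟨p.1, p.2, hp, hpC, hpS, coveringDim_primOfDim_cstarTensor_le fun k l hkl hk hl =>
    hmax (k, l) ⟨hkl, hk, hl⟩⟩

end DimRatio

theorem IrrepsDimGE.le_of_nonempty {A : Type u} [CStarAlgebra A] {J d : ℕ} (h : IrrepsDimGE A J)
    (hd : (primOfDim A d).Nonempty) : J ≤ d := by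
  obtain ⟨P, H, _, _, _, π, hπ, _, rfl, -⟩ := hd
  have := h H π hπ
  rw [← Module.finrank_eq_rank] at this
  exact_mod_cast this

theorem coveringDim_div_le_dimRatio {A : Type u} [CStarAlgebra A] {d : ℕ}
    (hd : (primOfDim A d).Nonempty) :
    (coveringDim (primOfDim A d) : ℝ≥0∞) / d ≤ dimRatio A :=
  le_iSup₂ (f := fun (d : ℕ) (_ : (primOfDim A d).Nonempty) =>
    (coveringDim (primOfDim A d) : ℝ≥0∞) / d) d hd

end

theorem lemma5p3_general {C : Type u} {S : Type v} [CStarAlgebra C] [CStarAlgebra S]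
    [TopologicalSpace.SeparableSpace C] [TopologicalSpace.SeparableSpace S] {J K : ℕ}
    (hC : IrrepsDimGE C J) (hS : IrrepsDimGE S K) :
    dimRatio (CStarTensor C S) ≤ dimRatio C / K + dimRatio S / J := by
  refine iSup₂_le fun d hd => ?_
  obtain ⟨k, l, rfl, hk, hl, hkl⟩ := exists_coveringDim_primOfDim_cstarTensor_le hd
  set x : ℝ≥0∞ := (coveringDim (primOfDim C k) : ℝ≥0∞)
  set y : ℝ≥0∞ := (coveringDim (primOfDim S l) : ℝ≥0∞)
  have hxy : (coveringDim (primOfDim (CStarTensor C S) (k * l)) : ℝ≥0∞) ≤ x + y := by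
    rw [← ENat.toENNReal_add]
    exact ENat.toENNReal_le.2 hkl
  have hJk : (J : ℝ≥0∞) ≤ k := by exact_mod_cast hC.le_of_nonempty hk
  have hKl : (K : ℝ≥0∞) ≤ l := by exact_mod_cast hS.le_of_nonempty hl
  have hmul (z : ℝ≥0∞) {m n : ℕ} : z / (m * n : ℕ) = z / m / n := by
    rw [Nat.cast_mul, div_eq_mul_inv, div_eq_mul_inv, div_eq_mul_inv, ENNReal.mul_inv, mul_assoc]
    · exact .inr (ENNReal.natCast_ne_top n)
    · exact .inl (ENNReal.natCast_ne_top m)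
  calc (coveringDim (primOfDim (CStarTensor C S) (k * l)) : ℝ≥0∞) / (k * l : ℕ)
      ≤ (x + y) / (k * l : ℕ) := by gcongr
    _ = x / k / l + y / l / k := by
      rw [ENNReal.add_div, hmul, mul_comm k l, hmul]
    _ ≤ dimRatio C / K + dimRatio S / J := by
      gcongr
      exacts [coveringDim_div_le_dimRatio hk, coveringDim_div_le_dimRatio hl]

theorem lemma5p3 {C : Type u} {S : Type v} [CStarAlgebra C] [CStarAlgebra S]
    [TopologicalSpace.SeparableSpace C] [TopologicalSpace.SeparableSpace S]
    (hC : IsSubhomogeneous C) (hS : IsSubhomogeneous S) (J : ℕ) (hJ : 0 < J)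
    (hCJ : IrrepsDimGE C J) (hSJ : IrrepsDimGE S J) :
    IsSubhomogeneous (CStarTensor C S) ∧
      dimRatio (CStarTensor C S) ≤ (dimRatio C + dimRatio S) / J :=
  ⟨hC.cstarTensor hS, (lemma5p3_general hCJ hSJ).trans_eq ENNReal.div_add_div_same⟩
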